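/- **Setting.** Let $n\ge 1$, $p,q\ge 1$ with $p+q=n+1$, $r\ge 1$, and $\theta\in[0,1]$. Let $\Omega\subset\mathbb R^n$ be a polyhedral domain with a conforming tessellation $\mathcal T_h$ into finitely many simplices, each oriented as $\mathbb R^n$. Let $\Delta(K)$ be the set of all subsimplices of $K$ (including $K$), $\mathcal F_o$ the set of external faces (facets of exactly one element), $\mathcal F_i$ the set of internal faces (facets shared by two elements, of which one is labelled left, $L$, and the other right, $R$). $\mathcal P_s\Lambda^k$ are the polynomial $k$-forms of degree $\le s$, and $\mathcal P^-_s\Lambda^k=\mathcal P_{s-1}\Lambda^k+\kappa\mathcal H_{s-1}\Lambda^{k+1}$ the trimmed ones ($\kappa$ the Koszul operator, $\mathcal H_{s-1}$ homogeneous of degree $s-1$; $\mathcal P_0^-\Lambda^k=0$). The discrete spaces on $K$ are given by either of the following two cases. * Case 1: $E_q(K)=\mathcal P_{r+1}\Lambda^{n-q}(K)$, $F_p(K)=\mathcal P_r\Lambda^p(K)$, $E_p(K)=\bigoplus_{f\in\Delta(K),\,\dim f\in[p,p+r-1]}\mathcal P^-_{r+p-\dim f}\Lambda^{\dim f-p}(f)$,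 $F_q(K)=\bigoplus_{f\in\Delta(K),\,\dim f\in[n-q,n-q+r]}\mathcal P^-_{r+1+n-q-\dim f}\Lambda^{\dim f-n+q}(f)$. * Case 2: $E_q(K)=\mathcal P^-_r\Lambda^{n-q}(K)$, $F_p(K)=\mathcal P^-_r\Lambda^p(K)$, $E_p(K)=\bigoplus_{f\in\Delta(K),\,\dim f\in[p,p+r-1]}\mathcal P_{r+p-\dim f-1}\Lambda^{\dim f-p}(f)$, $F_q(K)=\bigoplus_{f\in\Delta(K),\,\dim f\in[n-q,n-q+r-1]}\mathcal P_{r+n-q-\dim f-1}\Lambda^{\dim f-n+q}(f)$. $E_p(\mathcal T_h)$, $E_q(\mathcal T_h)$ consist of the fields that belong to $E_p(K)$, $E_q(K)$ on each $K$, with no continuity between elements. The operators $d_{qp}:E_p(K)\to F_q(K)$ (on each subsimplex $f$) and $d_{pq}:E_q(K)\to F_p(K)$ are the exterior derivative. The pairings are $$\langle f^p|e^p\rangle_K=\sum_f\int_f \mathrm{tr}_{K,f}f^p\wedge e^p_f=(-1)^{p(n-p)}\langle e^p|f^p\rangle_K,\qquad \langle e^q|f^q\rangle_K=\sum_f\int_f\mathrm{tr}_{K,f}e^q\wedge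 f^q_f .$$ On the boundary, $\mathrm{tr}_p e^p=(\mathrm{tr}_{f,\partial f}e^p_f)_f$, $\mathrm{tr}_q e^q=(\mathrm{tr}_{K,\partial f}e^q)_f$ and $\langle a|b\rangle_{\partial K}=\sum_{\dim f\in[p,p+r-1]}\int_{\partial f}a_f\wedge b_f$. For a facet $F$ of $K$, $\langle a|b\rangle_F$ is the part of this sum over the facets of the $f$ that lie in $F$ while $f$ itself does not, with the orientation induced from $K$. Here the subsimplices $f\neq K$ of each $K$ are oriented such that the orientations induced on a common boundary piece from the two sides of an internal face are opposite. **Discrete Hodge stars.** Let $C_p$, $C_q$ be coefficient functions, with $C_p$ integrable on every $f\in\Delta(K)$ with $\dim f\in[p,p+r-1]$ and $C_q$ integrable on every $K$, and $$g_{wp}(e,\tilde e)=\sum_{\dim f\in[p,p+r-1]}\int_f e_f\cdot\tilde e_f\,C_p\,d\mu,\qquad g_{wq}(e,\tilde e)=\int_K e\cdot\tilde e\,C_q\,d\mu .$$ For $\tilde e\in E_p(K)$, $\star_p\tilde e\in F_p(K)$ is defined by $\langle e|\star_p\tilde e\rangle_K=g_{wp}(e,\tilde e)$ for all $e\in E_p(K)$;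 for $\tilde e\in E_q(K)$, $\star_q\tilde e\in F_q(K)$ is defined by $\langle e|\star_q\tilde e\rangle_K=g_{wq}(e,\tilde e)$ for all $e\in E_q(K)$. **Discretization.** Let $I\subset\mathbb R$ be a time interval and $\beta^p_h(t)\in E_p(\mathcal T_h)$, $\beta^q_h(t)\in E_q(\mathcal T_h)$ differentiable in $t\in I$. On internal faces let the numerical fluxes be $$\hat\beta^p_h=(1-\theta)\,\mathrm{tr}_p\beta^p_h|_L+\theta\,\mathrm{tr}_p\beta^p_h|_R,\qquad \hat\beta^q_h=\theta\,\mathrm{tr}_q\beta^q_h|_L+(1-\theta)\,\mathrm{tr}_q\beta^q_h|_R,$$ and on external faces $\hat\beta^p_h=\tfrac12\mathrm{tr}_p\beta^p_h-u^p_h$, $\hat\beta^q_h=\tfrac12\mathrm{tr}_q\beta^q_h-u^q_h$ with arbitrary input ports $u^p_h(t)\in E_p(F)$, $u^q_h(t)\in E_q(F)$. Assume that for all $t\in I$, $\nu^p\in E_p(\mathcal T_h)$, $\nu^q\in E_q(\mathcal T_h)$, $$\sum_K\langle\nu^p|\star_p\dot\beta^p_h\rangle_K=\sum_K\langle\beta^q_h|d_{qp}\nu^p\rangle_K+(-1)^p\sum_{F\in\mathcal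 F_o}\langle\hat\beta^q_h|\mathrm{tr}_p\nu^p\rangle_F+(-1)^p\sum_{F\in\mathcal F_i}\langle\hat\beta^q_h|\mathrm{tr}_p\nu^p|_L+\mathrm{tr}_p\nu^p|_R\rangle_F,$$ $$\sum_K\langle\nu^q|\star_q\dot\beta^q_h\rangle_K=(-1)^{p+1}\sum_K\langle d_{pq}\nu^q|\beta^p_h\rangle_K+(-1)^p\sum_{F\in\mathcal F_o}\langle\mathrm{tr}_q\nu^q|\hat\beta^p_h\rangle_F+(-1)^p\sum_{F\in\mathcal F_i}\langle\mathrm{tr}_q\nu^q|_L+\mathrm{tr}_q\nu^q|_R|\hat\beta^p_h\rangle_F,$$ where on an internal face the $L$ and $R$ contributions are taken with the orientations induced from the left and the right element. On an internal face the input ports of the two elements are given by the interconnection structure: $$u^p_L=(\theta-\tfrac12)\mathrm{tr}_p\beta^p_h|_L-\theta\,\mathrm{tr}_p\beta^p_h|_R,\qquad u^q_L=(\tfrac12-\theta)\mathrm{tr}_q\beta^q_h|_L+(\theta-1)\mathrm{tr}_q\beta^q_h|_R,$$ $$u^p_R=-(1-\theta)\mathrm{tr}_p\beta^p_h|_L-(\theta-\tfrac12)\mathrm{tr}_p\beta^p_h|_R,\qquad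 u^q_R=-\theta\,\mathrm{tr}_q\beta^q_h|_L-(\tfrac12-\theta)\mathrm{tr}_q\beta^q_h|_R .$$ The output ports of each element are $y^p_h=(-1)^{p+1}\mathrm{tr}_p\beta^p_h$ and $y^q_h=(-1)^{p+1}\mathrm{tr}_q\beta^q_h$, and the discrete energy is $$E_h=\sum_{K\in\mathcal T_h}\big(\langle\beta^p_h|\star_p\beta^p_h\rangle_K+\langle\beta^q_h|\star_q\beta^q_h\rangle_K\big).$$ **Theorem 7.1 (Energy Conservation).** For all $t\in I$ the energy $E_h$ is differentiable in $I$ at $t$ and $$\dot E_h=2\sum_{F\in\mathcal F_o}\big(\langle y^q_h|u^p_h\rangle_F+\langle u^q_h|y^p_h\rangle_F\big).$$ Moreover, at each internal face the contributions of the two adjacent elements cancel: $$\big(\langle y^q_h|u^p_h\rangle_F+\langle u^q_h|y^p_h\rangle_F\big)_L+\big(\langle y^q_h|u^p_h\rangle_F+\langle u^q_h|y^p_h\rangle_F\big)_R=0\qquad(F\in\mathcal F_i).$$ -/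

import Mathlib

open MeasureTheory

noncomputable section

namespace PHDG

/-! ## Differential forms, polynomial and trimmed polynomial spaces -/

/-- Differential `k`-forms on a normed space `V` (no regularity built in). -/
abbrev DForm (V : Type*) [NormedAddCommGroup V] [NormedSpace ℝ V] (k : ℕ) : Type _ :=
  V → V [⋀^Fin k]→L[ℝ] ℝ

/-- The ambient Euclidean space `ℝⁿ`. -/
abbrev Amb (n : ℕ) : Type := EuclideanSpace ℝ (Fin n)

/-- The parameter space of an `m`-dimensional simplex (its affine coordinates). -/
abbrev Ref (m : ℕ) : Type := Fin m → ℝ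

/-- `𝒫_r Λ^k(ℝⁿ)`: the coefficients are polynomials of degree at most `r`. -/
def polyForms (n r k : ℕ) : Submodule ℝ (DForm (Amb n) k) where
  carrier := {ω | ∀ v : Fin k → Amb n, ∃ P : MvPolynomial (Fin n) ℝ,
    P.totalDegree ≤ r ∧ ∀ x : Amb n, ω x v = MvPolynomial.eval (fun i => x i) P}
  zero_mem' := fun _ => ⟨0, by simp, fun x => by simp⟩
  add_mem' := by
    intro a b ha hb v
    obtain ⟨P, hP, hP'⟩ := ha v
    obtain ⟨Q, hQ, hQ'⟩ := hb v
    exact ⟨P + Q, (MvPolynomial.totalDegree_add P Q).trans (max_le hP hQ),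
      fun x => by simp [hP', hQ']⟩
  smul_mem' := by
    intro c a ha v
    obtain ⟨P, hP, hP'⟩ := ha v
    exact ⟨c • P, (MvPolynomial.totalDegree_smul_le c P).trans hP,
      fun x => by simp [hP', MvPolynomial.smul_eval]⟩

/-- `ℋ_r Λ^k(ℝⁿ)`: the coefficients are homogeneous polynomials of degree `r`. -/
def homForms (n r k : ℕ) : Submodule ℝ (DForm (Amb n) k) where
  carrier := {ω | ∀ v : Fin k → Amb n, ∃ P : MvPolynomial (Fin n) ℝ,
    P.IsHomogeneous r ∧ ∀ x : Amb n, ω x v = MvPolynomial.eval (fun i => x i) P}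
  zero_mem' := fun _ => ⟨0, MvPolynomial.isHomogeneous_zero _ _ _, fun x => by simp⟩
  add_mem' := by
    intro a b ha hb v
    obtain ⟨P, hP, hP'⟩ := ha v
    obtain ⟨Q, hQ, hQ'⟩ := hb v
    exact ⟨P + Q, hP.add hQ, fun x => by simp [hP', hQ']⟩
  smul_mem' := by
    intro c a ha v
    obtain ⟨P, hP, hP'⟩ := ha v
    exact ⟨c • P, (MvPolynomial.homogeneousSubmodule (Fin n) ℝ r).smul_mem c hP,
      fun x => by simp [hP', MvPolynomial.smul_eval]⟩

/-- The Koszul operator: contraction with the position vector field. -/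
def koszul (n k : ℕ) : DForm (Amb n) (k + 1) →ₗ[ℝ] DForm (Amb n) k where
  toFun ω x := (ω x).curryLeft x
  map_add' _ _ := rfl
  map_smul' _ _ := rfl

/-- `𝒫⁻_r Λ^k(ℝⁿ) = 𝒫_{r-1} Λ^k + κ ℋ_{r-1} Λ^{k+1}` (the zero space for `r = 0`). -/
def trimmedForms (n : ℕ) : ℕ → (k : ℕ) → Submodule ℝ (DForm (Amb n) k)
  | 0, _ => ⊥
  | r + 1, k => polyForms n r k ⊔ (homForms n r (k + 1)).map (koszul n k)

/-! ## Affine simplices: parametrization, trace, integration, metric -/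

section Simplex

variable {V : Type*} [NormedAddCommGroup V] [NormedSpace ℝ V] {m : ℕ}

/-- Affine parametrization of the simplex with ordered vertices `w 0, …, w m`. -/
def param (w : Fin (m + 1) → V) (t : Ref m) : V :=
  w 0 + ∑ i, t i • (w i.succ - w 0)

/-- The linear part of `param w`. -/
def paramLin (w : Fin (m + 1) → V) : Ref m →L[ℝ] V :=
  ∑ i : Fin m, (ContinuousLinearMap.proj (R := ℝ) i).smulRight (w i.succ - w 0)

/-- The tangential trace of a form on the simplex with ordered vertices `w`: its pullback under the
affine parametrization. Forms on an `m`-simplex are throughout written in these coordinates, that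
is, as forms on `Ref m`. -/
def tr (w : Fin (m + 1) → V) {k : ℕ} : DForm V k →ₗ[ℝ] DForm (Ref m) k where
  toFun ω t := (ω (param w t)).compContinuousLinearMap (paramLin w)
  map_add' _ _ := rfl
  map_smul' _ _ := rfl

end Simplex

/-- The parameter domain of an `m`-simplex. -/
def refSimplex (m : ℕ) : Set (Ref m) := {t | (∀ i, 0 ≤ t i) ∧ ∑ i, t i ≤ 1}

/-- The vertices of the parameter domain. -/
def refVertex (m : ℕ) : Fin (m + 1) → Ref m := Fin.cons 0 fun i => Pi.single i 1

/-- The wedge product of an `a`-covector and a `b`-covector, evaluated on `m = a + b` vectors. -/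
def wedgeEval {V : Type*} [NormedAddCommGroup V] [NormedSpace ℝ V] {a b m : ℕ} (h : a + b = m)
    (α : V [⋀^Fin a]→L[ℝ] ℝ) (β : V [⋀^Fin b]→L[ℝ] ℝ) (v : Fin m → V) : ℝ :=
  ((a.factorial : ℝ) * (b.factorial : ℝ))⁻¹ * ∑ σ : Equiv.Perm (Fin m),
    ((Equiv.Perm.sign σ : ℤ) : ℝ) *
      (α (fun i => v (σ (Fin.cast h (Fin.castAdd b i)))) *
        β (fun i => v (σ (Fin.cast h (Fin.natAdd a i)))))

/-- `∫ α ∧ β` over an `m`-simplex, for forms `α`, `β` on the simplex of complementary degrees and the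
orientation given by the order of the vertices. -/
def wedgeInt {a b m : ℕ} (h : a + b = m) (α : DForm (Ref m) a) (β : DForm (Ref m) b) : ℝ :=
  ∫ t in refSimplex m, wedgeEval h (α t) (β t) (fun i => Pi.single i 1)

/-- Gram matrix of the edge vectors issuing from the first vertex. -/
def gram {n m : ℕ} (w : Fin (m + 1) → Amb n) : Matrix (Fin m) (Fin m) ℝ :=
  Matrix.of fun i j => inner ℝ (w i.succ - w 0) (w j.succ - w 0)

/-- The Euclidean inner product of two `k`-covectors tangent to the simplex `w`: the sum of the
products of their coefficients with respect to an orthonormal coframe of the simplex. -/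
def covectorInner {n m k : ℕ} (w : Fin (m + 1) → Amb n) (a b : Ref m [⋀^Fin k]→L[ℝ] ℝ) : ℝ :=
  (k.factorial : ℝ)⁻¹ * ∑ I : Fin k → Fin m, ∑ J : Fin k → Fin m,
    (∏ l, (gram w)⁻¹ (I l) (J l)) *
      (a (fun l => Pi.single (I l) 1) * b (fun l => Pi.single (J l) 1))

/-- `∫_f a(μ) · b(μ) · C(μ) dμ` over the `m`-simplex `f` with vertices `w`, `dμ` being its
`m`-dimensional Lebesgue measure. -/
def weightedInt {n m k : ℕ} (w : Fin (m + 1) → Amb n) (C : Amb n → ℝ)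
    (a b : DForm (Ref m) k) : ℝ :=
  ∫ t in refSimplex m,
    covectorInner w (a t) (b t) * C (param w t) * Real.sqrt (gram w).det

/-! ## Simplicial tessellations -/

/-- A conforming tessellation of a polyhedral domain of `ℝⁿ` into finitely many simplices; the domain
is the interior of their union. Vertices are numbered by a linearly ordered type, and an element is
the increasing list of its `n + 1` vertices. -/
structure Mesh (n : ℕ) (ι : Type*) [LinearOrder ι] where
  /-- positions of the vertices -/
  vert : ι → Amb n
  /-- the elements -/
  elems : Finset (Fin (n + 1) ↪o ι)
  /-- the elements are non-degenerate -/
  indep : ∀ K ∈ elems, AffineIndependent ℝ fun a => vert (K a)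
  /-- two elements meet in a common (possibly empty) subsimplex -/
  conforming : ∀ K ∈ elems, ∀ K' ∈ elems,
    convexHull ℝ (vert '' Set.range K) ∩ convexHull ℝ (vert '' Set.range K') ⊆
      convexHull ℝ (vert '' (Set.range K ∩ Set.range K'))

/-- The facet of the element `K` opposite to its `i`-th vertex. -/
def facet {n : ℕ} {ι : Type*} [LinearOrder ι] (K : Fin (n + 1) ↪o ι) (i : Fin (n + 1)) :
    Fin n ↪o ι :=
  (Fin.succAboveOrderEmb i).trans K

namespace Mesh

variable {n : ℕ} {ι : Type*} [LinearOrder ι] (M : Mesh n ι)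

/-- The ordered vertices of the `m`-dimensional subsimplex of `K` given by an increasing selection
of `m + 1` of the `n + 1` vertices of `K`. `Δ(K)` is the set of these selections, for all `m`. -/
def sub (K : Fin (n + 1) ↪o ι) {m : ℕ} (φ : Fin m ↪o Fin (n + 1)) : Fin m → Amb n :=
  fun a => M.vert (K (φ a))

open Classical in
/-- The pairs `(K, i)` such that `F` is the facet of the element `K` opposite to vertex `i`. -/
def sides (F : Fin n ↪o ι) : Finset ((Fin (n + 1) ↪o ι) × Fin (n + 1)) :=
  (M.elems ×ˢ Finset.univ).filter fun s => facet s.1 s.2 = F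

open Classical in
/-- All faces of the tessellation. -/
def faces : Finset (Fin n ↪o ι) :=
  (M.elems ×ˢ (Finset.univ : Finset (Fin (n + 1)))).image fun s => facet s.1 s.2

/-- Internal faces: the facets shared by different elements. -/
def internalFaces : Finset (Fin n ↪o ι) := M.faces.filter fun F => 1 < (M.sides F).card

/-- External faces: the facets that belong to a single element, that is, those on the boundary of
the domain. -/
def externalFaces : Finset (Fin n ↪o ι) := M.faces.filter fun F => (M.sides F).card = 1

/-- A choice of the left and of the right element at every internal face (each together with the
position of the vertex opposite to the face). -/
structure LeftRight where
  left : (Fin n ↪o ι) → (Fin (n + 1) ↪o ι) × Fin (n + 1)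
  right : (Fin n ↪o ι) → (Fin (n + 1) ↪o ι) × Fin (n + 1)
  left_mem : ∀ F ∈ M.internalFaces, left F ∈ M.sides F
  right_mem : ∀ F ∈ M.internalFaces, right F ∈ M.sides F
  left_ne_right : ∀ F ∈ M.internalFaces, left F ≠ right F

/-- The orientation of the element `K` inherited from `ℝⁿ`, compared with the order of its
vertices. -/
def elemSign (K : Fin (n + 1) ↪o ι) : ℝ :=
  Real.sign (Matrix.det (Matrix.of fun i j : Fin n => (M.vert (K i.succ) - M.vert (K 0)) j))

open Classical in
/-- The orientation of a subsimplex `f` of `K`, compared with the order of its vertices: the one for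
which the vertices of `K` not in `f` (in increasing order) followed by a positively oriented list of
the vertices of `f` is a positively oriented list of the vertices of `K`. For `f = K` this is the
orientation inherited from `ℝⁿ`. The orientations induced on a common face from its two sides are
opposite, also for the lower-dimensional subsimplices. -/
def subSign (K : Fin (n + 1) ↪o ι) {m : ℕ} (φ : Fin m ↪o Fin (n + 1)) : ℝ :=
  M.elemSign K * (-1) ^ (Finset.univ.filter fun ab : Fin (n + 1) × Fin (n + 1) =>
    ab.1 ∉ Set.range φ ∧ ab.2 ∈ Set.range φ ∧ ab.2 < ab.1).card

end Mesh

/-! ## Discrete spaces on an element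

Throughout, `s = n - q` is the degree of the forms in `E_q(K)`, so that `p = s + 1`. -/

/-- The two families of discrete spaces: `full` (Case 1, `E_q = 𝒫_{r+1} Λ^{n-q}`, `F_p = 𝒫_r Λ^p`)
and `trimmed` (Case 2, `E_q = 𝒫⁻_r Λ^{n-q}`, `F_p = 𝒫⁻_r Λ^p`). -/
inductive Family
  | full
  | trimmed

/-- `E_q(K)`. -/
def EqSpace (n s r : ℕ) : Family → Submodule ℝ (DForm (Amb n) s)
  | .full => polyForms n (r + 1) s
  | .trimmed => trimmedForms n r s

/-- `F_p(K)`. -/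
def FpSpace (n s r : ℕ) : Family → Submodule ℝ (DForm (Amb n) (s + 1))
  | .full => polyForms n r (s + 1)
  | .trimmed => trimmedForms n r (s + 1)

/-- The forms of degree `j = dim f - p < r` whose traces on `f` make up `E_p(f)`: `𝒫⁻_{r-j} Λ^j`,
respectively `𝒫_{r-j-1} Λ^j`. -/
def EpForms (n r j : ℕ) : Family → Submodule ℝ (DForm (Amb n) j)
  | .full => trimmedForms n (r - j) j
  | .trimmed => polyForms n (r - j - 1) j

/-- The forms of degree `i = dim f - (n - q)` whose traces on `f` make up `F_q(f)`:
`𝒫⁻_{r+1-i} Λ^i`, respectively `𝒫_{r-i-1} Λ^i`. -/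
def FqForms (n r i : ℕ) : Family → Submodule ℝ (DForm (Amb n) i)
  | .full => trimmedForms n (r + 1 - i) i
  | .trimmed => polyForms n (r - i - 1) i

/-- Number of degrees `i` occurring in `F_q(K)`. -/
def FqRange (r : ℕ) : Family → ℕ
  | .full => r + 1
  | .trimmed => r

/-- Vectors `(e_f)` of `j`-forms `e_f` on the subsimplices `f` of dimension `p + j`. -/
abbrev EpVec (n s : ℕ) : Type :=
  (j : ℕ) → (Fin (s + j + 2) ↪o Fin (n + 1)) → DForm (Ref (s + j + 1)) j

/-- Vectors `(f_f)` of `i`-forms on the subsimplices `f` of dimension `n - q + i`. -/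
abbrev FqVec (n s : ℕ) : Type :=
  (i : ℕ) → (Fin (s + i + 1) ↪o Fin (n + 1)) → DForm (Ref (s + i)) i

section Element

variable {n : ℕ} {ι : Type*} [LinearOrder ι] (M : Mesh n ι) {s : ℕ} (r : ℕ) (c : Family)

/-- Membership in `E_p(K) = ⊕_{dim f ∈ [p, p+r-1]} E_p(f)`. -/
def MemEp (K : Fin (n + 1) ↪o ι) (e : EpVec n s) : Prop :=
  ∀ j φ, (j < r → e j φ ∈ (EpForms n r j c).map (tr (M.sub K φ))) ∧ (r ≤ j → e j φ = 0)

/-- Membership in `F_q(K)`, the sum of the `F_q(f)` over `dim f ∈ [n-q, n-q+r]`, respectively over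
`dim f ∈ [n-q, n-q+r-1]`. -/
def MemFq (K : Fin (n + 1) ↪o ι) (f : FqVec n s) : Prop :=
  ∀ i φ, (i < FqRange r c → f i φ ∈ (FqForms n r i c).map (tr (M.sub K φ))) ∧
    (FqRange r c ≤ i → f i φ = 0)

/-- `d_{qp} : E_p(K) → F_q(K)`, the exterior derivative on each subsimplex. -/
def dqp (e : EpVec n s) : FqVec n s
  | 0, _ => 0
  | j + 1, φ => extDeriv (e j φ)

/-- `d_{pq} : E_q(K) → F_p(K)`, the exterior derivative. -/
def dpq (e : DForm (Amb n) s) : DForm (Amb n) (s + 1) := extDeriv e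

/-- `⟨f^p | e^p⟩_K = ∑_f ∫_f tr_{K,f} f^p ∧ e^p_f` for `f^p ∈ F_p(K)`, `e^p ∈ E_p(K)`. -/
def pairFpEp (K : Fin (n + 1) ↪o ι) (f : DForm (Amb n) (s + 1)) (e : EpVec n s) : ℝ :=
  ∑ j ∈ Finset.range r, ∑ φ : Fin (s + j + 2) ↪o Fin (n + 1),
    M.subSign K φ * wedgeInt (Nat.add_right_comm s 1 j) (tr (M.sub K φ) f) (e j φ)

/-- `⟨e^p | f^p⟩_K = (-1)^{p(n-p)} ⟨f^p | e^p⟩_K`. -/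
def pairEpFp (K : Fin (n + 1) ↪o ι) (e : EpVec n s) (f : DForm (Amb n) (s + 1)) : ℝ :=
  (-1) ^ ((s + 1) * (n - (s + 1))) * pairFpEp M r K f e

/-- `⟨e^q | f^q⟩_K = ∑_f ∫_f tr_{K,f} e^q ∧ f^q_f` for `e^q ∈ E_q(K)`, `f^q ∈ F_q(K)`. -/
def pairEqFq (K : Fin (n + 1) ↪o ι) (e : DForm (Amb n) s) (f : FqVec n s) : ℝ :=
  ∑ i ∈ Finset.range (r + 1), ∑ φ : Fin (s + i + 1) ↪o Fin (n + 1),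
    M.subSign K φ * wedgeInt rfl (tr (M.sub K φ) e) (f i φ)

/-- The weighted inner product `g_{wp}` on `E_p(K)`. -/
def gwp (Cp : Amb n → ℝ) (K : Fin (n + 1) ↪o ι) (e e' : EpVec n s) : ℝ :=
  ∑ j ∈ Finset.range r, ∑ φ : Fin (s + j + 2) ↪o Fin (n + 1),
    weightedInt (M.sub K φ) Cp (e j φ) (e' j φ)

/-- The weighted inner product `g_{wq}` on `E_q(K)`. -/
def gwq (Cq : Amb n → ℝ) (K : Fin (n + 1) ↪o ι) (e e' : DForm (Amb n) s) : ℝ :=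
  ∫ x in convexHull ℝ (Set.range fun a => M.vert (K a)),
    (∑ J : Fin s ↪o Fin n, e x (fun l => EuclideanSpace.single (J l) 1) *
      e' x (fun l => EuclideanSpace.single (J l) 1)) * Cq x

/-- `f = ⋆_p e`: the discrete Hodge star of `e ∈ E_p(K)` is the element of `F_p(K)` that represents
the functional `g_{wp}(·, e)` in the duality of `E_p(K)` and `F_p(K)`. -/
def IsHodgeStarP (Cp : Amb n → ℝ) (K : Fin (n + 1) ↪o ι) (e : EpVec n s)
    (f : DForm (Amb n) (s + 1)) : Prop :=
  f ∈ FpSpace n s r c ∧ ∀ e' : EpVec n s, MemEp M r c K e' →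
    pairEpFp M r K e' f = gwp M r Cp K e' e

/-- `f = ⋆_q e`: the discrete Hodge star of `e ∈ E_q(K)` is the element of `F_q(K)` that represents
the functional `g_{wq}(·, e)` in the duality of `E_q(K)` and `F_q(K)`. -/
def IsHodgeStarQ (Cq : Amb n → ℝ) (K : Fin (n + 1) ↪o ι) (e : DForm (Amb n) s)
    (f : FqVec n s) : Prop :=
  MemFq M r c K f ∧ ∀ e' ∈ EqSpace n s r c, pairEqFq M r K e' f = gwq M Cq K e' e

end Element

/-! ## Boundary variables

The boundary of `K` is understood as the collection of the boundaries of the subsimplices `f` of `K`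
with `dim f ∈ [p, p+r-1]`. A face of such an `f` lies in exactly one facet `F` of `K` not containing
`f`; conversely the subsimplices `g` of `F` with `dim g = n - q + j` correspond to the pairs `(f, g)`
where `f` is spanned by `g` and the vertex of `K` opposite to `F`. -/

/-- Variables in `E_p` on a facet: a `j`-form on each subsimplex of dimension `n - q + j`. -/
abbrev BdP (n s : ℕ) : Type :=
  (j : ℕ) → (Fin (s + j + 1) ↪o Fin n) → DForm (Ref (s + j)) j

/-- Variables in `E_q` on a facet: an `(n-q)`-form on each subsimplex of dimension `n - q + j`. -/
abbrev BdQ (n s : ℕ) : Type :=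
  (j : ℕ) → (Fin (s + j + 1) ↪o Fin n) → DForm (Ref (s + j)) s

/-- The position of the vertex `i` of `K` among the vertices of the simplex spanned by `i` and the
subsimplex `γ` of the facet opposite to `i`. -/
def insertPos {n m : ℕ} (i : Fin (n + 1)) (γ : Fin m ↪o Fin n) : Fin (m + 1) :=
  ⟨(Finset.univ.filter fun b : Fin m => i.succAbove (γ b) < i).card,
    Nat.lt_succ_of_le ((Finset.card_le_univ _).trans (by simp))⟩

/-- The simplex spanned by the vertex `i` of `K` and the subsimplex `γ` of the opposite facet. -/
def insertVertex {n m : ℕ} (i : Fin (n + 1)) (γ : Fin m ↪o Fin n) :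
    Fin (m + 1) ↪o Fin (n + 1) :=
  (insert i (Finset.univ.map
    (γ.trans (Fin.succAboveOrderEmb i)).toEmbedding)).orderEmbOfFin (by
      rw [Finset.card_insert_of_notMem, Finset.card_map, Finset.card_univ, Fintype.card_fin]
      simp [Fin.succAbove_ne])

section Boundary

variable {n : ℕ} {ι : Type*} [LinearOrder ι] (M : Mesh n ι) {s : ℕ} (r : ℕ) (c : Family)

/-- Membership in `E_p` of the face `F`. -/
def MemBdP (F : Fin n ↪o ι) (b : BdP n s) : Prop :=
  ∀ j < r, ∀ γ, b j γ ∈ (EpForms n r j c).map (tr fun a => M.vert (F (γ a)))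

/-- Membership in `E_q` of the face `F`. -/
def MemBdQ (F : Fin n ↪o ι) (b : BdQ n s) : Prop :=
  ∀ j < r, ∀ γ, b j γ ∈ (EqSpace n s r c).map (tr fun a => M.vert (F (γ a)))

/-- `tr_q e^q` on the `i`-th facet of `K`. -/
def trq (K : Fin (n + 1) ↪o ι) (i : Fin (n + 1)) (e : DForm (Amb n) s) : BdQ n s :=
  fun _ γ => tr (fun a => M.vert (facet K i (γ a))) e

/-- `tr_p e^p` on the `i`-th facet of an element: the traces `tr_{f,∂f} e^p_f`. -/
def trp (i : Fin (n + 1)) (e : EpVec n s) : BdP n s :=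
  fun j γ => tr (fun a => refVertex (s + j + 1) ((insertPos i γ).succAbove a))
    (e j (insertVertex i γ))

/-- The bilinear product `⟨a | b⟩_F` on the `i`-th facet `F` of `K`, with the orientation induced
from `K`: the part of `∑_f ∫_{∂f} a ∧ b` located in `F`. -/
def pairFace (K : Fin (n + 1) ↪o ι) (i : Fin (n + 1)) (a : BdQ n s) (b : BdP n s) : ℝ :=
  ∑ j ∈ Finset.range r, ∑ γ : Fin (s + j + 1) ↪o Fin n,
    M.subSign K (insertVertex i γ) * (-1) ^ (insertPos i γ : ℕ) * wedgeInt rfl (a j γ) (b j γ)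

end Boundary

/-! ## The interconnection and the discontinuous Galerkin formulation -/

/-- The interconnection Dirac structure with parameter `θ`, the variables in the duals of `E_p`
being represented by variables in `E_q`. -/
def Interconnection {n s : ℕ} (θ : ℝ) (wpL wpR : BdP n s) (wqL wqR yqL yqR : BdQ n s)
    (ypL ypR : BdP n s) : Prop :=
  wpL = (-(1 / 2) + θ) • ypL + (-θ) • ypR ∧
  wqL = (1 / 2 - θ) • yqL + (θ - 1) • yqR ∧
  wpR = (1 - θ) • ypL + (θ - 1 / 2) • ypR ∧
  wqR = θ • yqL + (1 / 2 - θ) • yqR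

section DG

variable {n : ℕ} {ι : Type*} [LinearOrder ι] (M : Mesh n ι) {s : ℕ} (r : ℕ) (c : Family)
  (θ : ℝ) (LR : M.LeftRight)

/-- The numerical flux `β̂^p` on an internal face. -/
def fluxP (βp : (Fin (n + 1) ↪o ι) → EpVec n s) (F : Fin n ↪o ι) : BdP n s :=
  (1 - θ) • trp (LR.left F).2 (βp (LR.left F).1) + θ • trp (LR.right F).2 (βp (LR.right F).1)

/-- The numerical flux `β̂^q` on an internal face. -/
def fluxQ (βq : (Fin (n + 1) ↪o ι) → DForm (Amb n) s) (F : Fin n ↪o ι) : BdQ n s :=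
  θ • trq M (LR.left F).1 (LR.left F).2 (βq (LR.left F).1) +
    (1 - θ) • trq M (LR.right F).1 (LR.right F).2 (βq (LR.right F).1)

/-- The numerical flux `β̂^p` on an external face with input `u^p`. -/
def fluxPExt (βp : (Fin (n + 1) ↪o ι) → EpVec n s)
    (uP : (Fin (n + 1) ↪o ι) → Fin (n + 1) → BdP n s) (K : Fin (n + 1) ↪o ι) (i : Fin (n + 1)) :
    BdP n s :=
  (1 / 2 : ℝ) • trp i (βp K) - uP K i

/-- The numerical flux `β̂^q` on an external face with input `u^q`. -/
def fluxQExt (βq : (Fin (n + 1) ↪o ι) → DForm (Amb n) s)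
    (uQ : (Fin (n + 1) ↪o ι) → Fin (n + 1) → BdQ n s) (K : Fin (n + 1) ↪o ι) (i : Fin (n + 1)) :
    BdQ n s :=
  (1 / 2 : ℝ) • trq M K i (βq K) - uQ K i

/-- The first equation of the DG discretization, for all test forms `ν^p ∈ E_p(𝒯_h)`; `fp` stands
for `⋆_p β̇^p`. On an internal face the contributions of the two sides are taken with the (opposite)
orientations induced from the two elements. -/
def WeakEqP (βq : (Fin (n + 1) ↪o ι) → DForm (Amb n) s)
    (fp : (Fin (n + 1) ↪o ι) → DForm (Amb n) (s + 1))
    (uQ : (Fin (n + 1) ↪o ι) → Fin (n + 1) → BdQ n s) : Prop :=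
  ∀ ν : (Fin (n + 1) ↪o ι) → EpVec n s, (∀ K ∈ M.elems, MemEp M r c K (ν K)) →
    ∑ K ∈ M.elems, pairEpFp M r K (ν K) (fp K) =
      ∑ K ∈ M.elems, pairEqFq M r K (βq K) (dqp (ν K)) +
      (-1) ^ (s + 1) * ∑ F ∈ M.externalFaces, ∑ S ∈ M.sides F,
        pairFace M r S.1 S.2 (fluxQExt M βq uQ S.1 S.2) (trp S.2 (ν S.1)) +
      (-1) ^ (s + 1) * ∑ F ∈ M.internalFaces,
        (pairFace M r (LR.left F).1 (LR.left F).2 (fluxQ M θ LR βq F)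
            (trp (LR.left F).2 (ν (LR.left F).1)) +
          pairFace M r (LR.right F).1 (LR.right F).2 (fluxQ M θ LR βq F)
            (trp (LR.right F).2 (ν (LR.right F).1)))

/-- The second equation of the DG discretization, for all test forms `ν^q ∈ E_q(𝒯_h)`; `fq` stands
for `⋆_q β̇^q`. -/
def WeakEqQ (βp : (Fin (n + 1) ↪o ι) → EpVec n s)
    (fq : (Fin (n + 1) ↪o ι) → FqVec n s)
    (uP : (Fin (n + 1) ↪o ι) → Fin (n + 1) → BdP n s) : Prop :=
  ∀ ν : (Fin (n + 1) ↪o ι) → DForm (Amb n) s, (∀ K ∈ M.elems, ν K ∈ EqSpace n s r c) →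
    ∑ K ∈ M.elems, pairEqFq M r K (ν K) (fq K) =
      (-1) ^ (s + 1 + 1) * ∑ K ∈ M.elems, pairFpEp M r K (dpq (ν K)) (βp K) +
      (-1) ^ (s + 1) * ∑ F ∈ M.externalFaces, ∑ S ∈ M.sides F,
        pairFace M r S.1 S.2 (trq M S.1 S.2 (ν S.1)) (fluxPExt βp uP S.1 S.2) +
      (-1) ^ (s + 1) * ∑ F ∈ M.internalFaces,
        (pairFace M r (LR.left F).1 (LR.left F).2
            (trq M (LR.left F).1 (LR.left F).2 (ν (LR.left F).1)) (fluxP M θ LR βp F) +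
          pairFace M r (LR.right F).1 (LR.right F).2
            (trq M (LR.right F).1 (LR.right F).2 (ν (LR.right F).1)) (fluxP M θ LR βp F))

/-- The discrete energy `E_h = ∑_K (⟨β^p | ⋆_p β^p⟩_K + ⟨β^q | ⋆_q β^q⟩_K)`, where `αp = ⋆_p β^p` and
`αq = ⋆_q β^q`. -/
def energy (βp : (Fin (n + 1) ↪o ι) → EpVec n s)
    (αp : (Fin (n + 1) ↪o ι) → DForm (Amb n) (s + 1))
    (βq : (Fin (n + 1) ↪o ι) → DForm (Amb n) s) (αq : (Fin (n + 1) ↪o ι) → FqVec n s) : ℝ :=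
  ∑ K ∈ M.elems, (pairEpFp M r K (βp K) (αp K) + pairEqFq M r K (βq K) (αq K))

/-- The output port `y^p = (-1)^{p+1} tr_p β^p` of the `i`-th facet of `K`. -/
def outP (βp : (Fin (n + 1) ↪o ι) → EpVec n s) (K : Fin (n + 1) ↪o ι) (i : Fin (n + 1)) :
    BdP n s :=
  ((-1 : ℝ) ^ (s + 1 + 1)) • trp i (βp K)

/-- The output port `y^q = (-1)^{p+1} tr_q β^q` of the `i`-th facet of `K`. -/
def outQ (βq : (Fin (n + 1) ↪o ι) → DForm (Amb n) s) (K : Fin (n + 1) ↪o ι) (i : Fin (n + 1)) :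
    BdQ n s :=
  ((-1 : ℝ) ^ (s + 1 + 1)) • trq M K i (βq K)

/-- The power `⟨y^q | u^p⟩_F + ⟨u^q | y^p⟩_F` entering `K` through its `i`-th facet `F`. -/
def portPower (βp : (Fin (n + 1) ↪o ι) → EpVec n s) (βq : (Fin (n + 1) ↪o ι) → DForm (Amb n) s)
    (uP : (Fin (n + 1) ↪o ι) → Fin (n + 1) → BdP n s)
    (uQ : (Fin (n + 1) ↪o ι) → Fin (n + 1) → BdQ n s)
    (K : Fin (n + 1) ↪o ι) (i : Fin (n + 1)) : ℝ :=
  pairFace M r K i (outQ M βq K i) (uP K i) + pairFace M r K i (uQ K i) (outP βp K i)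

/-- The elements on both sides of the face `F` are connected by the interconnection structure, with
`w_L = u_L`, `w_R = -u_R` and the traces of `β` as the other variables. -/
def InterconnectedAt (βp : (Fin (n + 1) ↪o ι) → EpVec n s)
    (βq : (Fin (n + 1) ↪o ι) → DForm (Amb n) s)
    (uP : (Fin (n + 1) ↪o ι) → Fin (n + 1) → BdP n s)
    (uQ : (Fin (n + 1) ↪o ι) → Fin (n + 1) → BdQ n s) (F : Fin n ↪o ι) : Prop :=
  Interconnection θ (uP (LR.left F).1 (LR.left F).2) (-uP (LR.right F).1 (LR.right F).2)
    (uQ (LR.left F).1 (LR.left F).2) (-uQ (LR.right F).1 (LR.right F).2)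
    (trq M (LR.left F).1 (LR.left F).2 (βq (LR.left F).1))
    (trq M (LR.right F).1 (LR.right F).2 (βq (LR.right F).1))
    (trp (LR.left F).2 (βp (LR.left F).1)) (trp (LR.right F).2 (βp (LR.right F).1))

end DG

end PHDG

end

/-!
# Energy conservation for the port-Hamiltonian discontinuous Galerkin discretization

On the time interval the defining property of the discrete Hodge stars turns the energy into
`∑ K, (g_wp(β^p, β^p) + g_wq(β^q, β^q))`. At every time the solution lies in a finite-dimensional
space of polynomial forms, in which a function is determined linearly by its values at finitely many
points (`exists_interpolation`); hence these quadratic expressions may be differentiated from the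
pointwise derivatives of `β` (`hasDerivWithinAt_integral_mul`), and by symmetry and the definition
of `⋆ β̇` the derivative is `2 ∑ K, (⟨β^p | ⋆ β̇^p⟩ + ⟨β^q | ⋆ β̇^q⟩)`.

Testing the two discrete equations with the solution expresses this sum by volume and flux terms
(`power_balance`). The volume terms are, up to sign, `∫ d(tr β^q ∧ β^p_f)` over the subsimplices
`f`, so they become boundary terms by integration by parts (`sum_pairFace_eq`). This rests on
Stokes' theorem on the parameter simplex (`wedgeInt_extDeriv`), obtained from the Leibniz rule for the
explicit wedge product and from Fubini's theorem with the fundamental theorem of calculus in each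
coordinate, and on the bijection `bijective_insertVertex`, which sorts the faces of the subsimplices
by the facets of the element that contain them.

The orientation factor of a face piece is the product of a factor of the element and a factor that
only depends on the face (`subSign_mul_neg_one_pow`). The factors of two elements sharing a facet
are opposite (`elemSign_opposite`): by conformity the elements lie on different sides of the facet,
since otherwise a point close to its barycenter would belong to both of them. The same argument
shows that an internal face has exactly two sides. Therefore the contributions of an internal face cancel, both
in the power balance (`internal_face_balance`) and for the interconnection structure
(`portPower_left_add_right`), and those of an external face add up to the supplied power
(`external_face_balance`).
-/

noncomputable section

namespace PHDG

/-! ### Permutation sums and the algebra of the wedge product -/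

section Permutations

variable {V : Type*} {m : ℕ}

theorem castAdd_succAbove_castAdd {a b m : ℕ} (h : a + b = m) (h' : a + 1 + b = m + 1)
    (i : Fin (a + 1)) (k : Fin a) :
    (Fin.cast h' (Fin.castAdd b i)).succAbove (Fin.cast h (Fin.castAdd b k)) =
      Fin.cast h' (Fin.castAdd b (i.succAbove k)) := by
  ext
  simp only [Fin.succAbove, Fin.lt_def]
  split_ifs <;> simp_all; omega

theorem castAdd_succAbove_natAdd {a b m : ℕ} (h : a + b = m) (h' : a + 1 + b = m + 1)
    (i : Fin (a + 1)) (k : Fin b) :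
    (Fin.cast h' (Fin.castAdd b i)).succAbove (Fin.cast h (Fin.natAdd a k)) =
      Fin.cast h' (Fin.natAdd (a + 1) k) := by
  ext
  have := i.2
  simp only [Fin.succAbove, Fin.lt_def]
  split_ifs <;> simp_all <;> omega

theorem natAdd_succAbove_castAdd {a b m : ℕ} (h : a + b = m) (h' : a + (b + 1) = m + 1)
    (i : Fin (b + 1)) (k : Fin a) :
    (Fin.cast h' (Fin.natAdd a i)).succAbove (Fin.cast h (Fin.castAdd b k)) =
      Fin.cast h' (Fin.castAdd (b + 1) k) := by
  ext
  have := k.2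
  simp only [Fin.succAbove, Fin.lt_def]
  split_ifs <;> simp_all; omega

theorem natAdd_succAbove_natAdd {a b m : ℕ} (h : a + b = m) (h' : a + (b + 1) = m + 1)
    (i : Fin (b + 1)) (k : Fin b) :
    (Fin.cast h' (Fin.natAdd a i)).succAbove (Fin.cast h (Fin.natAdd a k)) =
      Fin.cast h' (Fin.natAdd a (i.succAbove k)) := by
  ext
  simp only [Fin.succAbove, Fin.lt_def]
  split_ifs <;> simp_all <;> omega

theorem sign_cycleRange_symm_real (I : Fin (m + 1)) :
    ((Equiv.Perm.sign I.cycleRange.symm : ℤ) : ℝ) = (-1) ^ (I : ℕ) := by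
  rw [Equiv.Perm.sign_symm, Fin.sign_cycleRange]
  push_cast
  rfl

/-- In an alternating sum over permutations, a distinguished slot `I` may be moved to the front. -/
theorem sum_perm_move_slot (v : Fin (m + 1) → V) (G : V → (Fin m → V) → ℝ) (I : Fin (m + 1)) :
    ∑ σ : Equiv.Perm (Fin (m + 1)), ((Equiv.Perm.sign σ : ℤ) : ℝ) *
        G (v (σ I)) (fun j => v (σ (I.succAbove j))) =
      (-1) ^ (I : ℕ) * ∑ σ : Equiv.Perm (Fin (m + 1)), ((Equiv.Perm.sign σ : ℤ) : ℝ) *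
        G (v (σ 0)) (fun j => v (σ j.succ)) := by
  rw [← Equiv.sum_comp (Equiv.mulRight I.cycleRange.symm)
    (fun σ : Equiv.Perm (Fin (m + 1)) => ((Equiv.Perm.sign σ : ℤ) : ℝ) *
        G (v (σ 0)) (fun j => v (σ j.succ))), Finset.mul_sum]
  refine Finset.sum_congr rfl fun σ _ => ?_
  simp only [Equiv.coe_mulRight, Equiv.Perm.sign_mul, Units.val_mul, Int.cast_mul,
    sign_cycleRange_symm_real, Equiv.Perm.coe_mul, Function.comp_apply, Fin.cycleRange_symm_zero,
    Fin.cycleRange_symm_succ]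
  have : ((-1 : ℝ) ^ (I : ℕ)) * (-1) ^ (I : ℕ) = 1 := by
    rw [← mul_pow]; simp
  linear_combination (-(((Equiv.Perm.sign σ : ℤ) : ℝ) *
        G (v (σ I)) (fun j => v (σ (I.succAbove j))))) * this

/-- The permutation of `Fin (m + 1)` that sends `0` to `i` and follows `τ` on the other indices. -/
def permCons (x : Fin (m + 1) × Equiv.Perm (Fin m)) : Equiv.Perm (Fin (m + 1)) :=
  x.1.cycleRange.symm * Equiv.Perm.decomposeFin.symm (0, x.2)

theorem permCons_zero (x : Fin (m + 1) × Equiv.Perm (Fin m)) : permCons x 0 = x.1 := by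
  simp [permCons]

theorem permCons_succ (x : Fin (m + 1) × Equiv.Perm (Fin m)) (j : Fin m) :
    permCons x j.succ = x.1.succAbove (x.2 j) := by
  simp [permCons]

theorem sign_permCons (x : Fin (m + 1) × Equiv.Perm (Fin m)) :
    ((Equiv.Perm.sign (permCons x) : ℤ) : ℝ) =
      (-1) ^ (x.1 : ℕ) * ((Equiv.Perm.sign x.2 : ℤ) : ℝ) := by
  rw [permCons, Equiv.Perm.sign_mul, Units.val_mul, Int.cast_mul, sign_cycleRange_symm_real]
  simp [Equiv.Perm.decomposeFin.symm_sign]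

theorem permCons_bijective : Function.Bijective (permCons (m := m)) := by
  rw [Fintype.bijective_iff_injective_and_card]
  constructor
  · rintro ⟨i, τ⟩ ⟨i', τ'⟩ h
    have h0 := permCons_zero (i, τ)
    rw [h, permCons_zero] at h0
    obtain rfl : i' = i := h0
    refine Prod.ext rfl (Equiv.ext fun j => ?_)
    have hj := permCons_succ (i', τ) j
    rw [h, permCons_succ] at hj
    exact (Fin.succAbove_right_injective hj).symm
  · simp [Fintype.card_perm, Nat.factorial_succ]

/-- Laplace-type expansion of an alternating sum over permutations along the first slot. -/
theorem sum_perm_expand (v : Fin (m + 1) → V) (G : V → (Fin m → V) → ℝ) :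
    ∑ σ : Equiv.Perm (Fin (m + 1)), ((Equiv.Perm.sign σ : ℤ) : ℝ) *
        G (v (σ 0)) (fun j => v (σ j.succ)) =
      ∑ i : Fin (m + 1), (-1) ^ (i : ℕ) * ∑ τ : Equiv.Perm (Fin m),
        ((Equiv.Perm.sign τ : ℤ) : ℝ) * G (v i) (fun j => v (i.succAbove (τ j))) := by
  rw [← permCons_bijective.sum_comp, Fintype.sum_prod_type]
  refine Finset.sum_congr rfl fun i _ => ?_
  rw [Finset.mul_sum]
  refine Finset.sum_congr rfl fun τ _ => ?_
  simp only [permCons_zero, permCons_succ, sign_permCons]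
  ring

end Permutations

section Wedge

variable {V : Type*} [NormedAddCommGroup V] [NormedSpace ℝ V] {a b m : ℕ}

/-- The wedge product of two covectors as an alternating map; its values are given by
`wedgeEval`. -/
def wedge (h : a + b = m) (α : V [⋀^Fin a]→L[ℝ] ℝ) (β : V [⋀^Fin b]→L[ℝ] ℝ) :
    V [⋀^Fin m]→ₗ[ℝ] ℝ :=
  ((a.factorial : ℝ) * (b.factorial : ℝ))⁻¹ • MultilinearMap.alternatization
    (((LinearMap.mul' ℝ ℝ).compMultilinearMap
      (α.toAlternatingMap.toMultilinearMap.domCoprod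
        β.toAlternatingMap.toMultilinearMap)).domDomCongr (finSumFinEquiv.trans (finCongr h)))

theorem wedge_apply (h : a + b = m) (α : V [⋀^Fin a]→L[ℝ] ℝ) (β : V [⋀^Fin b]→L[ℝ] ℝ)
    (v : Fin m → V) : wedge h α β v = wedgeEval h α β v := by
  simp only [wedge, wedgeEval, AlternatingMap.smul_apply, MultilinearMap.alternatization_apply,
    smul_eq_mul]
  congr 1
  simp [Units.smul_def, zsmul_eq_mul]

theorem wedgeEval_add_left (h : a + b = m) (α α' : V [⋀^Fin a]→L[ℝ] ℝ) (β : V [⋀^Fin b]→L[ℝ] ℝ)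
    (v : Fin m → V) :
    wedgeEval h (α + α') β v = wedgeEval h α β v + wedgeEval h α' β v := by
  simp only [wedgeEval, ← mul_add, ← Finset.sum_add_distrib]
  congr 1
  exact Finset.sum_congr rfl fun σ _ => by rw [ContinuousAlternatingMap.add_apply]; ring

theorem wedgeEval_add_right (h : a + b = m) (α : V [⋀^Fin a]→L[ℝ] ℝ)
    (β β' : V [⋀^Fin b]→L[ℝ] ℝ) (v : Fin m → V) :
    wedgeEval h α (β + β') v = wedgeEval h α β v + wedgeEval h α β' v := by
  simp only [wedgeEval, ← mul_add, ← Finset.sum_add_distrib]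
  congr 1

theorem wedgeEval_smul_left (h : a + b = m) (c : ℝ) (α : V [⋀^Fin a]→L[ℝ] ℝ)
    (β : V [⋀^Fin b]→L[ℝ] ℝ) (v : Fin m → V) :
    wedgeEval h (c • α) β v = c * wedgeEval h α β v := by
  simp only [wedgeEval, Finset.mul_sum]
  exact Finset.sum_congr rfl fun σ _ => by
    rw [ContinuousAlternatingMap.smul_apply, smul_eq_mul]; ring

theorem wedgeEval_smul_right (h : a + b = m) (c : ℝ) (α : V [⋀^Fin a]→L[ℝ] ℝ)
    (β : V [⋀^Fin b]→L[ℝ] ℝ) (v : Fin m → V) :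
    wedgeEval h α (c • β) v = c * wedgeEval h α β v := by
  simp only [wedgeEval, Finset.mul_sum]
  exact Finset.sum_congr rfl fun σ _ => by
    rw [ContinuousAlternatingMap.smul_apply, smul_eq_mul]; ring

/-- Wedging the antisymmetrization of `A : V → Λᵃ` with a covector `β`: all slots of the first
factor contribute equally, which accounts for the factor `(a + 1)! / a!`. -/
theorem wedgeEval_alternatizeUncurryFin_left (h : a + b = m) (h' : a + 1 + b = m + 1)
    (A : V →L[ℝ] V [⋀^Fin a]→L[ℝ] ℝ) (β : V [⋀^Fin b]→L[ℝ] ℝ) (v : Fin (m + 1) → V) :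
    wedgeEval h' (.alternatizeUncurryFin A) β v =
      ∑ i : Fin (m + 1), (-1) ^ (i : ℕ) * wedgeEval h (A (v i)) β (i.removeNth v) := by
  set G : V → (Fin m → V) → ℝ := fun x w =>
    A x (fun k => w (Fin.cast h (Fin.castAdd b k))) * β (fun k => w (Fin.cast h (Fin.natAdd a k)))
    with hG
  have key := sum_perm_expand v G
  have hR : ∑ i : Fin (m + 1), (-1) ^ (i : ℕ) * wedgeEval h (A (v i)) β (i.removeNth v) =
      ((a.factorial : ℝ) * (b.factorial : ℝ))⁻¹ * ∑ σ : Equiv.Perm (Fin (m + 1)),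
        ((Equiv.Perm.sign σ : ℤ) : ℝ) * G (v (σ 0)) (fun j => v (σ j.succ)) := by
    rw [key, Finset.mul_sum]
    refine Finset.sum_congr rfl fun i _ => ?_
    simp only [wedgeEval, hG, Fin.removeNth]
    ring
  have hL : ∑ σ : Equiv.Perm (Fin (m + 1)), ((Equiv.Perm.sign σ : ℤ) : ℝ) *
      (ContinuousAlternatingMap.alternatizeUncurryFin A
        (fun i => v (σ (Fin.cast h' (Fin.castAdd b i)))) *
        β (fun i => v (σ (Fin.cast h' (Fin.natAdd (a + 1) i))))) =
      (a + 1) * ∑ σ : Equiv.Perm (Fin (m + 1)),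
        ((Equiv.Perm.sign σ : ℤ) : ℝ) * G (v (σ 0)) (fun j => v (σ j.succ)) := by
    have h1 : ∀ i : Fin (a + 1), ∑ σ : Equiv.Perm (Fin (m + 1)), ((Equiv.Perm.sign σ : ℤ) : ℝ) *
        ((-1) ^ (i : ℕ) * (A (v (σ (Fin.cast h' (Fin.castAdd b i))))
          (fun k => v (σ (Fin.cast h' (Fin.castAdd b (i.succAbove k))))) *
        β (fun i => v (σ (Fin.cast h' (Fin.natAdd (a + 1) i)))))) =
        ∑ σ : Equiv.Perm (Fin (m + 1)),
        ((Equiv.Perm.sign σ : ℤ) : ℝ) * G (v (σ 0)) (fun j => v (σ j.succ)) := by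
      intro i
      have h2 := sum_perm_move_slot v G (Fin.cast h' (Fin.castAdd b i))
      have h3 : ((-1 : ℝ) ^ (i : ℕ)) * (-1) ^ (i : ℕ) = 1 := by rw [← mul_pow]; simp
      simp only [hG, castAdd_succAbove_castAdd h h', castAdd_succAbove_natAdd h h'] at h2
      simp only [hG, mul_left_comm _ ((-1 : ℝ) ^ (i : ℕ)), ← Finset.mul_sum] at h2 ⊢
      rw [h2]
      simp only [Fin.val_cast, Fin.val_castAdd]
      rw [← mul_assoc, h3, one_mul]
    have h4 := Finset.sum_congr (rfl : (Finset.univ : Finset (Fin (a + 1))) = _) fun i _ => h1 i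
    rw [Finset.sum_const, Finset.card_univ, Fintype.card_fin, Finset.sum_comm, nsmul_eq_mul] at h4
    push_cast at h4
    rw [← h4]
    refine Finset.sum_congr rfl fun σ _ => ?_
    rw [ContinuousAlternatingMap.alternatizeUncurryFin_apply, Finset.sum_mul, Finset.mul_sum]
    refine Finset.sum_congr rfl fun i _ => ?_
    simp only [zsmul_eq_mul, Int.cast_pow, Int.cast_neg, Int.cast_one]
    simp +unfoldPartialApp only [Fin.removeNth]
    ring
  rw [hR, wedgeEval, hL, Nat.factorial_succ]
  push_cast
  have := Nat.factorial_ne_zero a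
  have := Nat.factorial_ne_zero b
  field_simp

/-- Wedging a covector `α` with the antisymmetrization of `B : V → Λᵇ`; the sign comes from moving
the new slot past those of `α`. -/
theorem wedgeEval_alternatizeUncurryFin_right (h : a + b = m) (h' : a + (b + 1) = m + 1)
    (α : V [⋀^Fin a]→L[ℝ] ℝ) (B : V →L[ℝ] V [⋀^Fin b]→L[ℝ] ℝ) (v : Fin (m + 1) → V) :
    (-1) ^ a * wedgeEval h' α (.alternatizeUncurryFin B) v =
      ∑ i : Fin (m + 1), (-1) ^ (i : ℕ) * wedgeEval h α (B (v i)) (i.removeNth v) := by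
  set G : V → (Fin m → V) → ℝ := fun x w =>
    α (fun k => w (Fin.cast h (Fin.castAdd b k))) * B x (fun k => w (Fin.cast h (Fin.natAdd a k)))
    with hG
  have key := sum_perm_expand v G
  have hR : ∑ i : Fin (m + 1), (-1) ^ (i : ℕ) * wedgeEval h α (B (v i)) (i.removeNth v) =
      ((a.factorial : ℝ) * (b.factorial : ℝ))⁻¹ * ∑ σ : Equiv.Perm (Fin (m + 1)),
        ((Equiv.Perm.sign σ : ℤ) : ℝ) * G (v (σ 0)) (fun j => v (σ j.succ)) := by
    rw [key, Finset.mul_sum]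
    refine Finset.sum_congr rfl fun i _ => ?_
    simp only [wedgeEval, hG, Fin.removeNth]
    ring
  have hL : (-1) ^ a * ∑ σ : Equiv.Perm (Fin (m + 1)), ((Equiv.Perm.sign σ : ℤ) : ℝ) *
      (α (fun i => v (σ (Fin.cast h' (Fin.castAdd (b + 1) i)))) *
        ContinuousAlternatingMap.alternatizeUncurryFin B
          (fun i => v (σ (Fin.cast h' (Fin.natAdd a i))))) =
      (b + 1) * ∑ σ : Equiv.Perm (Fin (m + 1)),
        ((Equiv.Perm.sign σ : ℤ) : ℝ) * G (v (σ 0)) (fun j => v (σ j.succ)) := by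
    have h1 : ∀ i : Fin (b + 1), ∑ σ : Equiv.Perm (Fin (m + 1)), ((Equiv.Perm.sign σ : ℤ) : ℝ) *
        ((-1) ^ (a + i : ℕ) * (α (fun k => v (σ (Fin.cast h' (Fin.castAdd (b + 1) k)))) *
          B (v (σ (Fin.cast h' (Fin.natAdd a i))))
          (fun k => v (σ (Fin.cast h' (Fin.natAdd a (i.succAbove k))))))) =
        ∑ σ : Equiv.Perm (Fin (m + 1)),
        ((Equiv.Perm.sign σ : ℤ) : ℝ) * G (v (σ 0)) (fun j => v (σ j.succ)) := by
      intro i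
      have h2 := sum_perm_move_slot v G (Fin.cast h' (Fin.natAdd a i))
      have h3 : ((-1 : ℝ) ^ (a + i : ℕ)) * (-1) ^ (a + i : ℕ) = 1 := by rw [← mul_pow]; simp
      simp only [hG, natAdd_succAbove_castAdd h h', natAdd_succAbove_natAdd h h'] at h2
      simp only [hG, mul_left_comm _ ((-1 : ℝ) ^ (a + i : ℕ)), ← Finset.mul_sum] at h2 ⊢
      rw [h2]
      simp only [Fin.val_cast, Fin.val_natAdd]
      rw [← mul_assoc, h3, one_mul]
    have h4 := Finset.sum_congr (rfl : (Finset.univ : Finset (Fin (b + 1))) = _) fun i _ => h1 i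
    rw [Finset.sum_const, Finset.card_univ, Fintype.card_fin, Finset.sum_comm, nsmul_eq_mul] at h4
    push_cast at h4
    rw [← h4, Finset.mul_sum]
    refine Finset.sum_congr rfl fun σ _ => ?_
    rw [ContinuousAlternatingMap.alternatizeUncurryFin_apply]
    simp only [Finset.mul_sum]
    refine Finset.sum_congr rfl fun i _ => ?_
    simp only [zsmul_eq_mul, Int.cast_pow, Int.cast_neg, Int.cast_one, pow_add]
    simp +unfoldPartialApp only [Fin.removeNth]
    ring
  rw [hR, wedgeEval, ← mul_assoc, mul_comm ((-1 : ℝ) ^ a), mul_assoc, hL, Nat.factorial_succ]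
  push_cast
  have := Nat.factorial_ne_zero a
  have := Nat.factorial_ne_zero b
  field_simp

end Wedge

/-! ### Affine parametrizations, traces and the Leibniz rule -/

section Trace

variable {V : Type*} [NormedAddCommGroup V] [NormedSpace ℝ V] {m k l : ℕ}

theorem paramLin_apply (w : Fin (m + 1) → V) (t : Ref m) :
    paramLin w t = ∑ i, t i • (w i.succ - w 0) := by
  simp [paramLin]

theorem param_eq (w : Fin (m + 1) → V) (t : Ref m) : param w t = w 0 + paramLin w t := by
  rw [paramLin_apply, param]

theorem paramLin_single (w : Fin (m + 1) → V) (i : Fin m) :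
    paramLin w (Pi.single i 1) = w i.succ - w 0 := by
  rw [paramLin_apply, Finset.sum_eq_single i] <;> simp +contextual

theorem param_refVertex (w : Fin (m + 1) → V) (a : Fin (m + 1)) :
    param w (refVertex m a) = w a := by
  rw [param_eq]
  refine Fin.cases ?_ (fun i => ?_) a
  · simp [refVertex]
  · simp [refVertex, paramLin_single]

theorem param_add_paramLin (w : Fin (m + 1) → V) (x y : Ref m) :
    param w (x + y) = param w x + paramLin w y := by
  rw [param_eq, param_eq, map_add, add_assoc]

theorem paramLin_comp_paramLin (w : Fin (m + 1) → V) (v : Fin (k + 1) → Ref m) :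
    (paramLin w).comp (paramLin v) = paramLin (param w ∘ v) := by
  ext t
  simp only [ContinuousLinearMap.comp_apply, paramLin_apply w, paramLin_apply v,
    paramLin_apply (param w ∘ v), Function.comp_apply, param_eq, add_sub_add_left_eq_sub]
  simp only [Finset.sum_apply, Pi.smul_apply, Pi.sub_apply, smul_eq_mul, Finset.sum_smul, mul_smul,
    ← Finset.sum_sub_distrib, ← sub_smul, Finset.smul_sum]
  exact Finset.sum_comm

theorem param_param (w : Fin (m + 1) → V) (v : Fin (k + 1) → Ref m) (t : Ref k) :
    param w (param v t) = param (param w ∘ v) t := by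
  rw [param_eq v, param_add_paramLin, param_eq (param w ∘ v), ← paramLin_comp_paramLin]
  rfl

theorem tr_tr (w : Fin (m + 1) → V) (v : Fin (k + 1) → Ref m) (ω : DForm V l) :
    tr v (tr w ω) = tr (param w ∘ v) ω := by
  funext t
  ext u
  change ω (param w (param v t)) _ = ω (param (param w ∘ v) t) (paramLin (param w ∘ v) ∘ u)
  rw [param_param, ← paramLin_comp_paramLin]
  rfl

theorem hasFDerivAt_param (w : Fin (m + 1) → V) (t : Ref m) :
    HasFDerivAt (param w) (paramLin w) t := by
  have : param w = fun t => w 0 + paramLin w t := funext (param_eq w)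
  rw [this]
  exact (paramLin w).hasFDerivAt.const_add (w 0)

theorem contDiff_param (w : Fin (m + 1) → V) {N : WithTop ℕ∞} : ContDiff ℝ N (param w) := by
  have : param w = fun t => w 0 + paramLin w t := funext (param_eq w)
  rw [this]
  exact contDiff_const.add (paramLin w).contDiff

theorem contDiff_tr (w : Fin (m + 1) → V) {ω : DForm V k} {N : WithTop ℕ∞}
    (hω : ContDiff ℝ N ω) : ContDiff ℝ N (tr w ω) :=
  (ContinuousAlternatingMap.compContinuousLinearMapCLM (ι := Fin k) (F := ℝ)
    (paramLin w)).contDiff.comp (hω.comp (contDiff_param w))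

theorem extDeriv_tr (w : Fin (m + 1) → V) {ω : DForm V k} (hω : ContDiff ℝ 1 ω) :
    extDeriv (tr w ω) = tr w (extDeriv ω) := by
  funext t
  have h := extDeriv_pullback (𝕜 := ℝ) (r := 2) (ω := ω) (f := param w) (x := t)
    (hω.differentiable one_ne_zero _) (contDiff_param w).contDiffAt (by simp)
  simp only [(hasFDerivAt_param w _).fderiv] at h
  exact h

theorem wedgeEval_tr {a b d : ℕ} (h : a + b = d) (w : Fin (m + 1) → V) (α : DForm V a)
    (β : DForm V b) (t : Ref m) (v : Fin d → Ref m) :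
    wedgeEval h (tr w α t) (tr w β t) v =
      wedgeEval h (α (param w t)) (β (param w t)) (fun i => paramLin w (v i)) := rfl

end Trace

section Leibniz

variable {V : Type*} [NormedAddCommGroup V] [NormedSpace ℝ V] {a b m : ℕ}

theorem contDiff_form_apply {ω : DForm V a} {N : WithTop ℕ∞} (hω : ContDiff ℝ N ω)
    (v : Fin a → V) : ContDiff ℝ N (fun x => ω x v) :=
  (ContinuousAlternatingMap.apply ℝ V ℝ v).contDiff.comp hω

theorem contDiff_wedgeEval (h : a + b = m) {α : DForm V a} {β : DForm V b} {N : WithTop ℕ∞}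
    (hα : ContDiff ℝ N α) (hβ : ContDiff ℝ N β) (v : Fin m → V) :
    ContDiff ℝ N (fun x => wedgeEval h (α x) (β x) v) := by
  unfold wedgeEval
  exact contDiff_const.mul (ContDiff.sum fun σ _ => contDiff_const.mul
    ((contDiff_form_apply hα _).mul (contDiff_form_apply hβ _)))

theorem continuous_wedgeEval (h : a + b = m) {α : DForm V a} {β : DForm V b}
    (hα : Continuous α) (hβ : Continuous β) (v : Fin m → V) :
    Continuous (fun x => wedgeEval h (α x) (β x) v) :=
  (contDiff_wedgeEval h (contDiff_zero.2 hα) (contDiff_zero.2 hβ) v).continuous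

theorem fderiv_wedgeEval (h : a + b = m) {α : DForm V a} {β : DForm V b}
    (hα : ContDiff ℝ 1 α) (hβ : ContDiff ℝ 1 β) (v : Fin m → V) (x y : V) :
    fderiv ℝ (fun x => wedgeEval h (α x) (β x) v) x y =
      wedgeEval h (fderiv ℝ α x y) (β x) v + wedgeEval h (α x) (fderiv ℝ β x y) v := by
  have hA : ∀ u, HasFDerivAt (fun x => α x u)
      ((ContinuousAlternatingMap.apply ℝ V ℝ u).comp (fderiv ℝ α x)) x := fun u =>
    (ContinuousAlternatingMap.apply ℝ V ℝ u).hasFDerivAt.comp x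
      (hα.differentiable one_ne_zero x).hasFDerivAt
  have hB : ∀ u, HasFDerivAt (fun x => β x u)
      ((ContinuousAlternatingMap.apply ℝ V ℝ u).comp (fderiv ℝ β x)) x := fun u =>
    (ContinuousAlternatingMap.apply ℝ V ℝ u).hasFDerivAt.comp x
      (hβ.differentiable one_ne_zero x).hasFDerivAt
  unfold wedgeEval
  rw [((HasFDerivAt.fun_sum fun σ _ => ((hA _).fun_mul (hB _)).const_mul _).const_mul _).fderiv]
  simp only [smul_apply, sum_apply,
    add_apply, ContinuousLinearMap.comp_apply, smul_eq_mul,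
    ContinuousAlternatingMap.apply_apply, ← mul_add, ← Finset.sum_add_distrib]
  congr 1
  refine Finset.sum_congr rfl fun σ _ => ?_
  ring

/-- The graded Leibniz rule `d(α ∧ β) = dα ∧ β + (-1)ᵃ α ∧ dβ`, with the left-hand side expanded. -/
theorem wedgeEval_extDeriv (h : a + b = m) (h₁ : a + 1 + b = m + 1) (h₂ : a + (b + 1) = m + 1)
    {α : DForm V a} {β : DForm V b} (hα : ContDiff ℝ 1 α) (hβ : ContDiff ℝ 1 β) (x : V)
    (v : Fin (m + 1) → V) :
    wedgeEval h₁ (extDeriv α x) (β x) v + (-1) ^ a * wedgeEval h₂ (α x) (extDeriv β x) v =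
      ∑ i : Fin (m + 1), (-1) ^ (i : ℕ) *
        fderiv ℝ (fun x => wedgeEval h (α x) (β x) (i.removeNth v)) x (v i) := by
  simp only [fderiv_wedgeEval h hα hβ, mul_add, Finset.sum_add_distrib]
  rw [extDeriv, extDeriv, wedgeEval_alternatizeUncurryFin_left h,
    wedgeEval_alternatizeUncurryFin_right h]

theorem continuous_extDeriv {α : DForm V a} (hα : ContDiff ℝ 1 α) : Continuous (extDeriv α) :=
  (ContinuousAlternatingMap.alternatizeUncurryFinCLM ℝ V ℝ).continuous.comp
    (hα.continuous_fderiv one_ne_zero)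

end Leibniz

/-! ### Stokes' theorem on the reference simplex -/

section Simplex

variable {m : ℕ}

theorem isClosed_refSimplex (m : ℕ) : IsClosed (refSimplex m) := by
  have : refSimplex m = (⋂ i, {t : Ref m | 0 ≤ t i}) ∩ {t | ∑ i, t i ≤ 1} := by
    ext t; simp [refSimplex]
  rw [this]
  exact (isClosed_iInter fun i => isClosed_le continuous_const (continuous_apply i)).inter
    (isClosed_le (by fun_prop) continuous_const)

theorem isCompact_refSimplex (m : ℕ) : IsCompact (refSimplex m) := by
  refine (isCompact_univ_pi fun _ : Fin m =>
    isCompact_Icc (a := (0 : ℝ)) (b := 1)).of_isClosed_subset (isClosed_refSimplex m) ?_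
  rintro t ⟨h0, h1⟩ i -
  exact ⟨h0 i, (Finset.single_le_sum (fun j _ => h0 j) (Finset.mem_univ i)).trans h1⟩

theorem integrableOn_refSimplex {f : Ref m → ℝ} (hf : Continuous f) :
    IntegrableOn f (refSimplex m) :=
  hf.continuousOn.integrableOn_compact (isCompact_refSimplex m)

theorem insertNth_mem_refSimplex (i : Fin (m + 1)) (x : ℝ) (u : Ref m) :
    (i.insertNth x u : Ref (m + 1)) ∈ refSimplex (m + 1) ↔
      u ∈ refSimplex m ∧ x ∈ Set.Icc 0 (1 - ∑ k, u k) := by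
  have h1 : ∑ k, (i.insertNth x u : Ref (m + 1)) k = x + ∑ k, u k := by
    rw [Fin.sum_univ_succAbove _ i]; simp
  simp only [refSimplex, Set.mem_ofPred_eq, h1, Set.mem_Icc]
  rw [Fin.forall_iff_succAbove i]
  simp only [Fin.insertNth_apply_same, Fin.insertNth_apply_succAbove]
  constructor
  · rintro ⟨⟨hx, hu⟩, hs⟩
    exact ⟨⟨hu, by linarith⟩, hx, by linarith⟩
  · rintro ⟨⟨hu, hs⟩, hx, hx'⟩
    exact ⟨⟨hx, hu⟩, by linarith⟩

theorem hasDerivAt_insertNth (i : Fin (m + 1)) (x : ℝ) (u : Ref m) :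
    HasDerivAt (fun x : ℝ => (i.insertNth x u : Ref (m + 1))) (Pi.single i 1) x := by
  rw [hasDerivAt_pi]
  intro k
  induction k using Fin.succAboveCases i with
  | x => simpa using hasDerivAt_id' x
  | p k => simpa [Fin.succAbove_ne] using hasDerivAt_const x (u k)

theorem continuous_insertNth (i : Fin (m + 1)) :
    Continuous fun p : ℝ × Ref m => (i.insertNth p.1 p.2 : Ref (m + 1)) := by
  refine continuous_pi fun k => ?_
  induction k using Fin.succAboveCases i with
  | x => simpa using continuous_fst
  | p k => simpa using (by fun_prop : Continuous fun a : ℝ × Ref m => a.2 k)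

/-- Fubini's theorem and the fundamental theorem of calculus in the direction of the `i`-th
coordinate. -/
theorem integral_fderiv_refSimplex (i : Fin (m + 1)) {g : Ref (m + 1) → ℝ} (hg : ContDiff ℝ 1 g) :
    ∫ t in refSimplex (m + 1), fderiv ℝ g t (Pi.single i 1) =
      (∫ u in refSimplex m, g (i.insertNth (1 - ∑ k, u k) u)) -
        ∫ u in refSimplex m, g (i.insertNth 0 u) := by
  set f : Ref (m + 1) → ℝ := fun t => fderiv ℝ g t (Pi.single i 1) with hf
  have hfc : Continuous f := (hg.continuous_fderiv one_ne_zero).clm_apply continuous_const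
  have hmS : ∀ d, MeasurableSet (refSimplex d) := fun d => (isClosed_refSimplex d).measurableSet
  set e := MeasurableEquiv.piFinSuccAbove (fun _ : Fin (m + 1) => ℝ) i
  have he : ∀ p : ℝ × Ref m, e.symm p = i.insertNth p.1 p.2 := fun p => rfl
  have hmp : MeasurePreserving e.symm (volume : Measure (ℝ × Ref m)) volume :=
    (volume_preserving_piFinSuccAbove (fun _ : Fin (m + 1) => ℝ) i).symm e
  have hFint : Integrable (fun p : ℝ × Ref m => (refSimplex (m + 1)).indicator f (e.symm p))
      (volume.prod volume) :=
    hmp.integrable_comp_of_integrable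
      ((integrable_indicator_iff (hmS _)).2 (integrableOn_refSimplex hfc))
  have h1 : ∫ t in refSimplex (m + 1), f t =
      ∫ u : Ref m, ∫ x : ℝ, (refSimplex (m + 1)).indicator f (e.symm (x, u)) := by
    rw [← integral_indicator (hmS _), ← hmp.integral_comp' (f := e.symm)]
    exact integral_prod_symm _ hFint
  have h2 : ∀ u : Ref m, ∫ x : ℝ, (refSimplex (m + 1)).indicator f (e.symm (x, u)) =
      (refSimplex m).indicator (fun u => g (i.insertNth (1 - ∑ k, u k) u) -
        g (i.insertNth 0 u)) u := by
    intro u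
    by_cases hu : u ∈ refSimplex m
    · rw [Set.indicator_of_mem hu]
      have hle : (0 : ℝ) ≤ 1 - ∑ k, u k := sub_nonneg.2 hu.2
      have : ∀ x : ℝ, (refSimplex (m + 1)).indicator f (e.symm (x, u)) =
          (Set.Icc 0 (1 - ∑ k, u k)).indicator (fun x => f (i.insertNth x u)) x := by
        intro x
        by_cases hx : x ∈ Set.Icc 0 (1 - ∑ k, u k)
        · rw [Set.indicator_of_mem hx, Set.indicator_of_mem
            (by rw [he]; exact (insertNth_mem_refSimplex i x u).2 ⟨hu, hx⟩), he]
        · rw [Set.indicator_of_notMem hx, Set.indicator_of_notMem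
            (by rw [he, insertNth_mem_refSimplex]; exact fun h => hx h.2)]
      simp only [this]
      rw [integral_indicator measurableSet_Icc, integral_Icc_eq_integral_Ioc,
        ← intervalIntegral.integral_of_le hle]
      refine intervalIntegral.integral_eq_sub_of_hasDerivAt (f := fun x => g (i.insertNth x u))
        (fun x _ => ?_) ?_
      · exact (hg.differentiable one_ne_zero _).hasFDerivAt.comp_hasDerivAt x
          (hasDerivAt_insertNth i x u)
      · exact (hfc.comp ((continuous_insertNth i).comp
          (continuous_id.prodMk continuous_const))).intervalIntegrable _ _
    · rw [Set.indicator_of_notMem hu]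
      have : ∀ x : ℝ, (refSimplex (m + 1)).indicator f (e.symm (x, u)) = 0 := fun x =>
        Set.indicator_of_notMem (by rw [he, insertNth_mem_refSimplex]; exact fun h => hu h.1) _
      simp [this]
  rw [h1]
  simp only [h2]
  rw [integral_indicator (hmS _), integral_sub]
  · exact integrableOn_refSimplex (hg.continuous.comp ((continuous_insertNth i).comp
      (Continuous.prodMk (by fun_prop) continuous_id)))
  · exact integrableOn_refSimplex (hg.continuous.comp ((continuous_insertNth i).comp
      (Continuous.prodMk (by fun_prop) continuous_id)))

/-- The affine involution of the reference simplex that exchanges the vertices `0` and `k + 1`: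
the coordinate `t k` is replaced by the barycentric coordinate of the vertex `0`. -/
def swapZero (k : Fin m) (t : Ref m) : Ref m := Function.update t k (1 - ∑ i, t i)

theorem sum_swapZero (k : Fin m) (t : Ref m) : ∑ i, swapZero k t i = 1 - t k := by
  rw [swapZero, Finset.sum_update_of_mem (Finset.mem_univ k), ← Finset.erase_eq,
    ← Finset.add_sum_erase _ t (Finset.mem_univ k)]
  ring

theorem swapZero_involutive (k : Fin m) : Function.Involutive (swapZero k) := by
  intro t
  conv_lhs => rw [swapZero, sum_swapZero]
  rw [swapZero, Function.update_idem]
  simp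

theorem swapZero_preimage (k : Fin m) : swapZero k ⁻¹' refSimplex m = refSimplex m := by
  have h : ∀ t, t ∈ refSimplex m → swapZero k t ∈ refSimplex m := by
    rintro t ⟨h0, h1⟩
    refine ⟨fun i => ?_, by rw [sum_swapZero]; linarith [h0 k]⟩
    by_cases hi : i = k
    · subst hi; simp [swapZero, h1]
    · simp [swapZero, hi, h0 i]
  ext t
  exact ⟨fun ht => by simpa [swapZero_involutive k t] using h _ ht, h t⟩

/-- The linear part of `swapZero k`. -/
def swapZeroLin (k : Fin m) : Ref m →ₗ[ℝ] Ref m where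
  toFun t := Function.update t k (-∑ i, t i)
  map_add' t u := by
    ext i
    by_cases hi : i = k
    · subst hi; simp [Finset.sum_add_distrib]; ring
    · simp [hi]
  map_smul' c t := by
    ext i
    by_cases hi : i = k
    · subst hi; simp [Finset.mul_sum]
    · simp [hi]

theorem swapZero_eq (k : Fin m) (t : Ref m) :
    swapZero k t = swapZeroLin k t + Pi.single k 1 := by
  ext i
  by_cases hi : i = k
  · subst hi; simp [swapZero, swapZeroLin]; ring
  · simp [swapZero, swapZeroLin, hi]

theorem det_swapZeroLin (k : Fin m) : |LinearMap.det (swapZeroLin k)| = 1 := by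
  have h : swapZeroLin k * swapZeroLin k = 1 := by
    apply LinearMap.ext
    intro t
    have h1 := swapZero_involutive k t
    have h0 := swapZero_involutive k 0
    rw [swapZero_eq, swapZero_eq, map_add] at h1 h0
    rw [map_zero, map_zero, zero_add] at h0
    rw [add_assoc, h0, add_zero] at h1
    exact h1
  have h2 := congrArg LinearMap.det h
  rw [map_mul, map_one] at h2
  rcases mul_self_eq_one_iff.1 h2 with h | h <;> simp [h]

theorem continuous_swapZero (k : Fin m) : Continuous (swapZero k) :=
  continuous_id.update k (by fun_prop)

/-- `swapZero k` is an affine involution, so it preserves volume. -/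
theorem measurePreserving_swapZero (k : Fin m) :
    MeasurePreserving (swapZero k) (volume : Measure (Ref m)) volume := by
  have hd := det_swapZeroLin k
  have hd0 : LinearMap.det (swapZeroLin k) ≠ 0 := fun h => by simp [h] at hd
  have hL : MeasurePreserving (swapZeroLin k) (volume : Measure (Ref m)) volume := by
    refine ⟨(LinearMap.continuous_of_finiteDimensional _).measurable, ?_⟩
    rw [Real.map_linearMap_volume_pi_eq_smul_volume_pi hd0, abs_inv, hd]
    simp
  have := (measurePreserving_add_right (volume : Measure (Ref m)) (Pi.single k 1)).comp hL
  have h : swapZero k = (fun x => x + Pi.single k 1) ∘ swapZeroLin k :=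
    funext (swapZero_eq k)
  rw [h]
  exact this

theorem insertNth_succ_eq_swapZero {M : ℕ} (k : Fin M) (u : Ref M) :
    (k.succ.insertNth (1 - ∑ j, u j) u : Ref (M + 1)) =
      k.castSucc.insertNth (1 - ∑ j, swapZero k u j) (swapZero k u) := by
  rw [sum_swapZero, eq_comm, Fin.insertNth_eq_iff]
  constructor
  · have : k.castSucc = k.succ.succAbove k := by simp
    rw [this, Fin.insertNth_apply_succAbove]; ring
  · funext j
    by_cases hj : j = k
    · subst hj
      simp [swapZero, Fin.removeNth]
    · simp only [swapZero, ne_eq, hj, not_false_eq_true, Function.update_of_ne, Fin.removeNth]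
      have : k.castSucc.succAbove j = k.succ.succAbove j := by
        rcases lt_or_gt_of_ne hj with h | h
        · rw [Fin.succAbove_castSucc_of_lt _ _ h, Fin.succAbove_of_castSucc_lt]
          exact (Fin.castSucc_lt_castSucc_iff.2 h).trans Fin.castSucc_lt_succ
        · rw [Fin.succAbove_castSucc_of_le _ _ h.le, Fin.succAbove_of_le_castSucc]
          exact Fin.succ_le_castSucc_iff.2 h
      rw [this, Fin.insertNth_apply_succAbove]

/-- The integral over the face `∑ t = 1` does not depend on the coordinate that is eliminated. -/
theorem integral_insertNth_eq_zero (g : Ref (m + 1) → ℝ) (i : Fin (m + 1)) :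
    ∫ u in refSimplex m, g (i.insertNth (1 - ∑ k, u k) u) =
      ∫ u in refSimplex m, g ((0 : Fin (m + 1)).insertNth (1 - ∑ k, u k) u) := by
  induction i using Fin.induction with
  | zero => rfl
  | succ k ih =>
    rw [← ih]
    have h := (measurePreserving_swapZero k).setIntegral_preimage_emb
      (MeasurableEquiv.ofInvolutive _ (swapZero_involutive k)
        (continuous_swapZero k).measurable).measurableEmbedding
      (fun u => g (k.castSucc.insertNth (1 - ∑ j, u j) u)) (refSimplex m)
    rw [swapZero_preimage] at h
    simp only [insertNth_succ_eq_swapZero]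
    exact h

/-- An alternating form on the edges issuing from the first vertex of the face opposite to the
origin, expressed through the coordinate faces: evaluate `σ ∧ θ`, where `σ` is the sum of the
coordinates, on `(e₀, e₁, …)` and on `(e₀, e₁ - e₀, …)`. -/
theorem alternating_edges (θ : Ref (m + 1) [⋀^Fin m]→ₗ[ℝ] ℝ) :
    θ (fun k => Pi.single k.succ 1 - Pi.single 0 1) =
      ∑ i : Fin (m + 1), (-1) ^ (i : ℕ) * 
        θ (i.removeNth (α := fun _ => Ref (m + 1)) fun k => Pi.single k 1) := by
  set σ : Ref (m + 1) →ₗ[ℝ] ℝ := ∑ i, LinearMap.proj i with hσ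
  have hσ1 : ∀ k, σ (Pi.single k 1) = 1 := by intro k; simp [hσ]
  set Θ := AlternatingMap.alternatizeUncurryFin (σ.smulRight θ) with hΘ
  set e : Fin (m + 1) → Ref (m + 1) := fun k => Pi.single k 1 with he
  set u : Fin (m + 1) → Ref (m + 1) :=
    Fin.cons (e 0) fun k : Fin m => e k.succ - e 0 with hu
  have hΘe : Θ e = ∑ i : Fin (m + 1), (-1) ^ (i : ℕ) * θ (i.removeNth e) := by
    rw [hΘ, AlternatingMap.alternatizeUncurryFin_apply]
    refine Finset.sum_congr rfl fun i _ => ?_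
    simp [he, hσ1]
  have hΘu : Θ u = θ (fun k => e k.succ - e 0) := by
    rw [hΘ, AlternatingMap.alternatizeUncurryFin_apply, Fin.sum_univ_succ]
    have h0 : ∀ i : Fin m, σ (u i.succ) = 0 := by
      intro i; simp [hu, he, hσ1]
    simp only [LinearMap.smulRight_apply, AlternatingMap.smul_apply, h0]
    simp only [zero_smul, smul_zero, Finset.sum_const_zero, add_zero]
    simp only [hu, Fin.cons_zero, he, hσ1]
    simp
  rw [← hΘu, ← hΘe, AlternatingMap.eq_smul_basis_det (Pi.basisFun ℝ (Fin (m + 1))) Θ]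
  simp only [AlternatingMap.smul_apply, Module.Basis.det_apply]
  congr 1
  have hdet : ∀ w : Fin (m + 1) → Ref (m + 1),
      ((Pi.basisFun ℝ (Fin (m + 1))).toMatrix w).det = (Matrix.of w).det := by
    intro w
    rw [← Matrix.det_transpose]
    rfl
  rw [hdet, hdet]
  refine Matrix.det_eq_of_forall_row_eq_smul_add_const (Fin.cons 0 fun _ => -1) 0 rfl ?_
  intro i j
  refine Fin.cases ?_ (fun i => ?_) i
  · simp [hu]
  · simp [hu]; ring

end Simplex

section Stokes

variable {a b m : ℕ}

theorem param_refVertex_zero_face (u : Ref m) :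
    param (fun k => refVertex (m + 1) ((0 : Fin (m + 2)).succAbove k)) u =
      (0 : Fin (m + 1)).insertNth (1 - ∑ k, u k) u := by
  rw [param, eq_comm, Fin.insertNth_eq_iff]
  constructor
  · simp [refVertex]
    ring
  · funext j
    simp [refVertex, Fin.removeNth, Pi.single_apply, Fin.succ_ne_zero]

theorem param_refVertex_succ_face (i : Fin (m + 1)) (u : Ref m) :
    param (fun k => refVertex (m + 1) (i.succ.succAbove k)) u = i.insertNth 0 u := by
  rw [param, eq_comm, Fin.insertNth_eq_iff]
  constructor
  · simp [refVertex]
  · funext j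
    simp [refVertex, Fin.removeNth, Pi.single_apply]

theorem wedgeEval_zero_face (h : a + b = m) (α : DForm (Ref (m + 1)) a)
    (β : DForm (Ref (m + 1)) b) (t : Ref m) :
    wedgeEval h (tr (fun k => refVertex (m + 1) ((0 : Fin (m + 2)).succAbove k)) α t)
        (tr (fun k => refVertex (m + 1) ((0 : Fin (m + 2)).succAbove k)) β t)
        (fun i => Pi.single i 1) =
      ∑ i : Fin (m + 1), (-1) ^ (i : ℕ) *
        wedgeEval h (α ((0 : Fin (m + 1)).insertNth (1 - ∑ k, t k) t))
          (β ((0 : Fin (m + 1)).insertNth (1 - ∑ k, t k) t))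
          (i.removeNth (α := fun _ => Ref (m + 1)) fun k => Pi.single k 1) := by
  rw [wedgeEval_tr, param_refVertex_zero_face]
  simp only [← wedge_apply, ← alternating_edges]
  congr 1
  funext i
  rw [paramLin_single]
  simp [refVertex]

theorem wedgeEval_succ_face (h : a + b = m) (α : DForm (Ref (m + 1)) a)
    (β : DForm (Ref (m + 1)) b) (i : Fin (m + 1)) (t : Ref m) :
    wedgeEval h (tr (fun k => refVertex (m + 1) (i.succ.succAbove k)) α t)
        (tr (fun k => refVertex (m + 1) (i.succ.succAbove k)) β t)
        (fun i => Pi.single i 1) =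
      wedgeEval h (α (i.insertNth 0 t)) (β (i.insertNth 0 t))
          (i.removeNth (α := fun _ => Ref (m + 1)) fun k => Pi.single k 1) := by
  rw [wedgeEval_tr, param_refVertex_succ_face]
  congr 1
  funext k
  rw [paramLin_single]
  simp [refVertex, Fin.removeNth]

/-- Integration by parts on the reference simplex: `∫ dα ∧ β + (-1)ᵃ ∫ α ∧ dβ` is the integral of
`α ∧ β` over the boundary, the facet opposite to the vertex `k` having the sign `(-1)ᵏ`. -/
theorem wedgeInt_extDeriv (h : a + b = m) (h₁ : a + 1 + b = m + 1) (h₂ : a + (b + 1) = m + 1)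
    {α : DForm (Ref (m + 1)) a} {β : DForm (Ref (m + 1)) b} (hα : ContDiff ℝ 1 α)
    (hβ : ContDiff ℝ 1 β) :
    wedgeInt h₁ (extDeriv α) β + (-1) ^ a * wedgeInt h₂ α (extDeriv β) =
      ∑ k : Fin (m + 2), (-1) ^ (k : ℕ) *
        wedgeInt h (tr (fun l => refVertex (m + 1) (k.succAbove l)) α)
          (tr (fun l => refVertex (m + 1) (k.succAbove l)) β) := by
  set g : Fin (m + 1) → Ref (m + 1) → ℝ := fun i x =>
    wedgeEval h (α x) (β x) (i.removeNth (α := fun _ => Ref (m + 1)) fun k => Pi.single k 1)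
    with hg
  have hgs : ∀ i, ContDiff ℝ 1 (g i) := fun i => contDiff_wedgeEval h hα hβ _
  have hL : wedgeInt h₁ (extDeriv α) β + (-1) ^ a * wedgeInt h₂ α (extDeriv β) =
      ∑ i : Fin (m + 1), (-1) ^ (i : ℕ) *
        ∫ t in refSimplex (m + 1), fderiv ℝ (g i) t (Pi.single i 1) := by
    simp only [wedgeInt, ← integral_const_mul]
    rw [← integral_add, ← integral_finsetSum]
    · refine integral_congr_ae (Filter.Eventually.of_forall fun t => ?_)
      exact wedgeEval_extDeriv h h₁ h₂ hα hβ t _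
    · intro i _
      exact integrableOn_refSimplex (continuous_const.mul
        (((hgs i).continuous_fderiv one_ne_zero).clm_apply continuous_const))
    · exact integrableOn_refSimplex
        (continuous_wedgeEval h₁ (continuous_extDeriv hα) hβ.continuous _)
    · exact integrableOn_refSimplex (continuous_const.mul
        (continuous_wedgeEval h₂ hα.continuous (continuous_extDeriv hβ) _))
  rw [hL, Fin.sum_univ_succ (n := m + 1)]
  have h0 : wedgeInt h (tr (fun l => refVertex (m + 1) ((0 : Fin (m + 2)).succAbove l)) α)
      (tr (fun l => refVertex (m + 1) ((0 : Fin (m + 2)).succAbove l)) β) =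
      ∑ i : Fin (m + 1), (-1) ^ (i : ℕ) *
        ∫ u in refSimplex m, g i ((0 : Fin (m + 1)).insertNth (1 - ∑ k, u k) u) := by
    simp only [wedgeInt, wedgeEval_zero_face, ← integral_const_mul]
    rw [integral_finsetSum]
    intro i _
    exact integrableOn_refSimplex (continuous_const.mul ((hgs i).continuous.comp
      ((continuous_insertNth 0).comp (Continuous.prodMk (by fun_prop) continuous_id))))
  have hs : ∀ i : Fin (m + 1),
      wedgeInt h (tr (fun l => refVertex (m + 1) (i.succ.succAbove l)) α)
        (tr (fun l => refVertex (m + 1) (i.succ.succAbove l)) β) =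
      ∫ u in refSimplex m, g i (i.insertNth 0 u) := by
    intro i
    simp only [wedgeInt, wedgeEval_succ_face, hg]
  simp only [hs, h0, integral_fderiv_refSimplex _ (hgs _), integral_insertNth_eq_zero]
  rw [Fin.val_zero, pow_zero, one_mul, ← Finset.sum_add_distrib]
  refine Finset.sum_congr rfl fun i _ => ?_
  rw [Fin.val_succ, pow_succ]
  ring

end Stokes

/-! ### Faces of subsimplices and integration by parts on an element -/

section Faces

variable {n m : ℕ}

theorem range_insertVertex (i : Fin (n + 1)) (γ : Fin m ↪o Fin n) :
    Set.range (insertVertex i γ) = insert i (Set.range fun b => i.succAbove (γ b)) := by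
  rw [insertVertex, Finset.range_orderEmbOfFin]
  ext x
  simp [eq_comm]

theorem insertVertex_eq {φ : Fin (m + 1) ↪o Fin (n + 1)} {a : Fin (m + 1)} {γ : Fin m ↪o Fin n}
    (h : ∀ b, φ (a.succAbove b) = (φ a).succAbove (γ b)) : insertVertex (φ a) γ = φ := by
  apply DFunLike.coe_injective
  refine ((insertVertex (φ a) γ).strictMono.range_inj φ.strictMono).1 ?_
  rw [range_insertVertex]
  ext x
  simp only [← h, Set.mem_insert_iff, Set.mem_range]
  rw [Fin.exists_iff_succAbove a]
  simp [eq_comm]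

theorem insertPos_eq {φ : Fin (m + 1) ↪o Fin (n + 1)} {a : Fin (m + 1)} {γ : Fin m ↪o Fin n}
    (h : ∀ b, φ (a.succAbove b) = (φ a).succAbove (γ b)) : insertPos (φ a) γ = a := by
  ext
  simp only [insertPos, ← h, φ.lt_iff_lt]
  have : (Finset.univ.filter fun b : Fin m => a.succAbove b < a) =
      Finset.univ.filter fun b : Fin m => (b : ℕ) < a := by
    ext b
    simp only [Fin.succAbove_lt_iff_castSucc_lt]
    rfl
  rw [this]
  have := a.2
  simp [Fin.card_filter_val_lt]
  omega

theorem exists_insertVertex_eq (i : Fin (n + 1)) (γ : Fin m ↪o Fin n) :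
    ∃ a, insertVertex i γ a = i ∧
      ∀ b, insertVertex i γ (a.succAbove b) = i.succAbove (γ b) := by
  obtain ⟨a, ha⟩ : i ∈ Set.range (insertVertex i γ) := by
    rw [range_insertVertex]; exact Set.mem_insert _ _
  refine ⟨a, ha, fun b => ?_⟩
  refine congrFun (((((insertVertex i γ).strictMono.comp (Fin.strictMono_succAbove a))).range_inj
    ((Fin.strictMono_succAbove i).comp γ.strictMono)).1 ?_) b
  rw [Set.range_comp, Fin.range_succAbove, Set.image_compl_eq_range_sdiff_image
    (insertVertex i γ).injective, range_insertVertex, Set.image_singleton, ha]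
  ext x
  simp only [Set.mem_sdiff, Set.mem_insert_iff, Set.mem_range, Set.mem_singleton_iff,
    Function.comp_apply]
  constructor
  · rintro ⟨h | h, h'⟩
    · exact absurd h h'
    · exact h
  · rintro ⟨b, rfl⟩
    exact ⟨Or.inr ⟨b, rfl⟩, Fin.succAbove_ne _ _⟩

theorem insertVertex_insertPos (i : Fin (n + 1)) (γ : Fin m ↪o Fin n) :
    insertVertex i γ (insertPos i γ) = i := by
  obtain ⟨a, ha, h⟩ := exists_insertVertex_eq i γ
  have := insertPos_eq (φ := insertVertex i γ) (a := a) (γ := γ) (by rwa [ha])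
  rw [ha] at this
  rw [this, ha]

theorem insertVertex_succAbove (i : Fin (n + 1)) (γ : Fin m ↪o Fin n) (b : Fin m) :
    insertVertex i γ ((insertPos i γ).succAbove b) = i.succAbove (γ b) := by
  obtain ⟨a, ha, h⟩ := exists_insertVertex_eq i γ
  have := insertPos_eq (φ := insertVertex i γ) (a := a) (γ := γ) (by rwa [ha])
  rw [ha] at this
  rw [this, h]

/-- The pairs of a subsimplex and one of its vertices correspond to the pairs of a vertex of the
element and a subsimplex of the opposite facet. -/
theorem bijective_insertVertex :
    Function.Bijective fun x : Fin (n + 1) × (Fin m ↪o Fin n) =>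
      (insertVertex x.1 x.2, insertPos x.1 x.2) := by
  constructor
  · rintro ⟨i, γ⟩ ⟨i', γ'⟩ h
    obtain ⟨h1, h2⟩ := Prod.ext_iff.1 h
    simp only at h1 h2
    have hi := insertVertex_insertPos i γ
    rw [h1, h2, insertVertex_insertPos] at hi
    subst hi
    refine Prod.ext rfl (DFunLike.ext _ _ fun b => ?_)
    have hb := insertVertex_succAbove i' γ b
    rw [h1, h2, insertVertex_succAbove] at hb
    exact (Fin.succAbove_right_injective hb).symm
  · rintro ⟨φ, a⟩
    have hne : ∀ b, φ (a.succAbove b) ≠ φ a := fun b h => Fin.succAbove_ne a b (φ.injective h)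
    choose γ hγ using fun b => Fin.exists_succAbove_eq (hne b)
    have hmono : StrictMono γ := by
      intro b b' hbb
      rw [← (Fin.strictMono_succAbove (φ a)).lt_iff_lt, hγ, hγ]
      exact φ.strictMono (Fin.strictMono_succAbove a hbb)
    refine ⟨(φ a, OrderEmbedding.ofStrictMono γ hmono), ?_⟩
    have h : ∀ b, φ (a.succAbove b) = (φ a).succAbove (OrderEmbedding.ofStrictMono γ hmono b) :=
      fun b => (hγ b).symm
    exact Prod.ext (insertVertex_eq h) (insertPos_eq h)

end Faces

section Element

variable {n : ℕ} {ι : Type*} [LinearOrder ι] (M : Mesh n ι) {s : ℕ} (r : ℕ)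

theorem tr_face_tr_sub (K : Fin (n + 1) ↪o ι) (i : Fin (n + 1)) {m k : ℕ}
    (γ : Fin (m + 1) ↪o Fin n) (α : DForm (Amb n) k) :
    tr (fun a => refVertex (m + 1) ((insertPos i γ).succAbove a))
        (tr (M.sub K (insertVertex i γ)) α) =
      tr (fun a => M.vert (facet K i (γ a))) α := by
  rw [tr_tr]
  congr 1
  congr 1
  funext a
  simp only [Function.comp_apply, param_refVertex, Mesh.sub, insertVertex_succAbove]
  rfl

/-- Integration by parts on an element: the boundary terms on all subsimplices are collected by the
facets of the element. -/
theorem sum_pairFace_eq (K : Fin (n + 1) ↪o ι) {α : DForm (Amb n) s} (hα : ContDiff ℝ 1 α)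
    {e : EpVec n s} (he : ∀ j φ, ContDiff ℝ 1 (e j φ)) :
    ∑ i, pairFace M r K i (trq M K i α) (trp i e) =
      pairFpEp M r K (dpq α) e + (-1) ^ s * pairEqFq M r K α (dqp e) := by
  have h0 : ∀ φ : Fin (s + 0 + 1) ↪o Fin (n + 1),
      wedgeInt rfl (tr (M.sub K φ) α) (dqp e 0 φ) = 0 := by
    intro φ
    simp [wedgeInt, wedgeEval, dqp]
  simp only [pairFace, pairFpEp, pairEqFq]
  rw [Finset.sum_comm, Finset.sum_range_succ']
  simp only [h0, mul_zero, Finset.sum_const_zero, add_zero]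
  rw [Finset.mul_sum, ← Finset.sum_add_distrib]
  refine Finset.sum_congr rfl fun j _ => ?_
  rw [Finset.mul_sum]
  have hb := (bijective_insertVertex (n := n) (m := s + j + 1)).sum_comp
    (fun x : (Fin (s + j + 2) ↪o Fin (n + 1)) × Fin (s + j + 2) =>
      M.subSign K x.1 * (-1) ^ (x.2 : ℕ) * wedgeInt rfl
        (tr (fun a => refVertex (s + j + 1) (x.2.succAbove a)) (tr (M.sub K x.1) α))
        (tr (fun a => refVertex (s + j + 1) (x.2.succAbove a)) (e j x.1)))
  rw [Fintype.sum_prod_type, Fintype.sum_prod_type] at hb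
  simp only [tr_face_tr_sub] at hb
  refine (hb.trans (Finset.sum_congr rfl fun φ _ => ?_)).trans
    (Finset.sum_add_distrib (s := Finset.univ)
      (f := fun φ : Fin (s + j + 2) ↪o Fin (n + 1) => M.subSign K φ *
        wedgeInt (Nat.add_right_comm s 1 j) (tr (M.sub K φ) (dpq α)) (e j φ))
      (g := fun φ : Fin (s + j + 2) ↪o Fin (n + 1) => (-1) ^ s * (M.subSign K φ *
        wedgeInt (rfl : s + (j + 1) = s + j + 1) (tr (M.sub K φ) α) (extDeriv (e j φ)))))
  have hS := wedgeInt_extDeriv (rfl : s + j = s + j) (Nat.add_right_comm s 1 j) rfl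
    (contDiff_tr (M.sub K φ) hα) (he j φ)
  rw [extDeriv_tr _ hα] at hS
  simp only [mul_assoc, ← Finset.mul_sum]
  rw [← hS, mul_add]
  simp only [dpq]
  ring

end Element

/-! ### Orientation of the two sides of a face -/

section Orientation

variable {n : ℕ}

/-- The matrix whose rows are the homogeneous coordinates of `n + 1` points of `ℝⁿ`. -/
def homMatrix (v : Fin (n + 1) → Amb n) : Matrix (Fin (n + 1)) (Fin (n + 1)) ℝ :=
  Matrix.of fun a => Fin.cons 1 fun j => v a j

/-- Up to the factor `n!`, the signed volume of the simplex with ordered vertices `v`. -/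
def homDet (v : Fin (n + 1) → Amb n) : ℝ := (homMatrix v).det

theorem vecMul_homMatrix_zero (v : Fin (n + 1) → Amb n) (w : Fin (n + 1) → ℝ) :
    Matrix.vecMul w (homMatrix v) 0 = ∑ a, w a := by
  simp [Matrix.vecMul, dotProduct, homMatrix]

theorem vecMul_homMatrix_succ (v : Fin (n + 1) → Amb n) (w : Fin (n + 1) → ℝ) (j : Fin n) :
    Matrix.vecMul w (homMatrix v) j.succ = (∑ a, w a • v a) j := by
  simp [Matrix.vecMul, dotProduct, homMatrix]

theorem homDet_ne_zero {v : Fin (n + 1) → Amb n} (hv : AffineIndependent ℝ v) :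
    homDet v ≠ 0 := by
  intro h
  obtain ⟨w, hw, hw0⟩ := Matrix.exists_vecMul_eq_zero_iff.2 h
  refine hw (funext fun a => ?_)
  refine (affineIndependent_iff.1 hv) Finset.univ w ?_ ?_ a (Finset.mem_univ a)
  · rw [← vecMul_homMatrix_zero v, hw0]; rfl
  · ext j
    rw [← vecMul_homMatrix_succ, hw0]; rfl

/-- Barycentric coordinates with respect to a non-degenerate simplex. -/
theorem exists_barycentric {v : Fin (n + 1) → Amb n} (hv : homDet v ≠ 0) (x : Amb n) :
    ∃ w : Fin (n + 1) → ℝ, ∑ a, w a = 1 ∧ ∑ a, w a • v a = x := by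
  have hu : IsUnit (homMatrix v).det := isUnit_iff_ne_zero.2 hv
  refine ⟨Matrix.vecMul (Fin.cons 1 fun j => x j) (homMatrix v)⁻¹, ?_, ?_⟩
  · rw [← vecMul_homMatrix_zero v, Matrix.vecMul_vecMul, Matrix.nonsing_inv_mul _ hu,
      Matrix.vecMul_one]
    rfl
  · ext j
    rw [← vecMul_homMatrix_succ, Matrix.vecMul_vecMul, Matrix.nonsing_inv_mul _ hu,
      Matrix.vecMul_one]
    rfl

theorem det_edges_eq_homDet (v : Fin (n + 1) → Amb n) :
    Matrix.det (Matrix.of fun i j : Fin n => (v i.succ - v 0) j) = homDet v := by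
  have h : homDet v = Matrix.det (Matrix.of (Fin.cons (homMatrix v 0)
      fun i : Fin n => homMatrix v i.succ - homMatrix v 0)) := by
    refine Matrix.det_eq_of_forall_row_eq_smul_add_const (Fin.cons 0 fun _ => 1) 0 rfl ?_
    intro i j
    refine Fin.cases ?_ (fun i => ?_) i <;> simp
  rw [h, Matrix.det_succ_column_zero, Fin.sum_univ_succ]
  simp [homMatrix]
  rfl

theorem homDet_cons_removeNth (v : Fin (n + 1) → Amb n) (i : Fin (n + 1)) :
    homDet (Fin.cons (v i) fun b => v (i.succAbove b)) = (-1) ^ (i : ℕ) * homDet v := by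
  have h : homMatrix (Fin.cons (v i) fun b => v (i.succAbove b)) =
      (homMatrix v).submatrix i.cycleRange.symm id := by
    ext a j
    refine Fin.cases ?_ (fun a => ?_) a <;> simp [homMatrix]
  rw [homDet, h, Matrix.det_permute, sign_cycleRange_symm_real]
  rfl

/-- `homDet` is an affine function of the first vertex. Together with `homDet_cons_self` it cuts out
the hyperplane through the other vertices and distinguishes its two sides. -/
theorem homDet_cons_affine (F : Fin n → Amb n) {ι' : Type*} (t : Finset ι') (w : ι' → ℝ)
    (z : ι' → Amb n) (hw : ∑ a ∈ t, w a = 1) :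
    homDet (Fin.cons (∑ a ∈ t, w a • z a) F) = ∑ a ∈ t, w a * homDet (Fin.cons (z a) F) := by
  have h : ∀ x : Amb n, homDet (Fin.cons x F) =
      ∑ j : Fin (n + 1), (-1) ^ (j : ℕ) * (Fin.cons 1 (fun k => x k) : Fin (n + 1) → ℝ) j *
        ((Matrix.of fun a : Fin n => (Fin.cons 1 fun k => F a k : Fin (n + 1) → ℝ)).submatrix id
          j.succAbove).det := by
    intro x
    rw [homDet, Matrix.det_succ_row_zero]
    rfl
  simp only [h, Finset.mul_sum]
  rw [Finset.sum_comm]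
  refine Finset.sum_congr rfl fun j _ => ?_
  refine Fin.cases ?_ (fun j => ?_) j
  · simp only [Fin.cons_zero, ← Finset.sum_mul, hw]
    simp
  · simp only [Fin.cons_succ]
    simp only [PiLp.smul_apply, WithLp.ofLp_sum, Finset.sum_apply, smul_eq_mul, Finset.mul_sum,
      Finset.sum_mul]
    refine Finset.sum_congr rfl fun a _ => ?_
    simp
    ring

theorem homDet_cons_self (F : Fin n → Amb n) (b : Fin n) : homDet (Fin.cons (F b) F) = 0 := by
  refine Matrix.det_zero_of_row_eq (Fin.succ_ne_zero b).symm ?_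
  funext j
  simp [homMatrix]

variable {ι : Type*} [LinearOrder ι] (M : Mesh n ι)

theorem elemSign_mul_neg_one_pow (K : Fin (n + 1) ↪o ι) (i : Fin (n + 1)) :
    M.elemSign K * (-1) ^ (i : ℕ) =
      Real.sign (homDet (Fin.cons (M.vert (K i)) fun b => M.vert (facet K i b))) := by
  have h := homDet_cons_removeNth (fun a => M.vert (K a)) i
  have h' : homDet (Fin.cons (M.vert (K i)) fun b => M.vert (facet K i b)) =
      (-1) ^ (i : ℕ) * homDet (fun a => M.vert (K a)) := h
  rw [h', Mesh.elemSign, det_edges_eq_homDet (fun a => M.vert (K a))]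
  rcases neg_one_pow_eq_or ℝ (i : ℕ) with hi | hi <;> rw [hi]
  · simp
  · rw [neg_one_mul, Real.sign_neg]; ring

theorem mem_range_facet_or (K : Fin (n + 1) ↪o ι) (i : Fin (n + 1)) (a : Fin (n + 1)) :
    a = i ∨ ∃ b, K a = facet K i b := by
  refine Fin.succAboveCases i (Or.inl rfl) (fun b => Or.inr ⟨b, rfl⟩) a

theorem apply_ne_facet (K : Fin (n + 1) ↪o ι) (i : Fin (n + 1)) (b : Fin n) :
    K i ≠ facet K i b := fun h => Fin.succAbove_ne i b (K.injective h).symm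

theorem range_eq_insert_facet (K : Fin (n + 1) ↪o ι) (i : Fin (n + 1)) :
    Set.range K = insert (K i) (Set.range (facet K i)) := by
  ext x
  constructor
  · rintro ⟨a, rfl⟩
    rcases mem_range_facet_or K i a with rfl | ⟨b, hb⟩
    · exact Set.mem_insert _ _
    · exact Or.inr ⟨b, hb.symm⟩
  · rintro (rfl | ⟨b, rfl⟩)
    · exact ⟨i, rfl⟩
    · exact ⟨i.succAbove b, rfl⟩

theorem eq_of_facet_eq {K K' : Fin (n + 1) ↪o ι} {i i' : Fin (n + 1)}
    (hF : facet K i = facet K' i') (hv : K i = K' i') : (K, i) = (K', i') := by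
  have hK : K = K' := by
    apply DFunLike.coe_injective
    refine (K.strictMono.range_inj K'.strictMono).1 ?_
    rw [range_eq_insert_facet K i, range_eq_insert_facet K' i', hF, hv]
  subst hK
  rw [K.injective hv]

/-- The vertices opposite to a common facet of two elements lie on different sides of it. Otherwise
a point near the barycenter of the facet and off its hyperplane would belong to both elements, but
by conformity these meet inside that hyperplane only. -/
theorem homDet_mul_neg (hn : 0 < n) {K K' : Fin (n + 1) ↪o ι} (hK : K ∈ M.elems)
    (hK' : K' ∈ M.elems) {i i' : Fin (n + 1)} (hF : facet K i = facet K' i')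
    (hne : (K, i) ≠ (K', i')) :
    homDet (Fin.cons (M.vert (K i)) fun b => M.vert (facet K i b)) *
      homDet (Fin.cons (M.vert (K' i')) fun b => M.vert (facet K' i' b)) < 0 := by
  have hnz : ∀ L ∈ M.elems, ∀ l : Fin (n + 1),
      homDet (Fin.cons (M.vert (L l)) fun b => M.vert (facet L l b)) ≠ 0 := by
    intro L hL l
    have h := homDet_cons_removeNth (fun a => M.vert (L a)) l
    have h' : homDet (Fin.cons (M.vert (L l)) fun b => M.vert (facet L l b)) =
      (-1) ^ (l : ℕ) * homDet (fun a => M.vert (L a)) := h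
    rw [h']
    exact mul_ne_zero (pow_ne_zero _ (by norm_num)) (homDet_ne_zero (M.indep L hL))
  have h1 := hnz K hK i
  have h2 := hnz K' hK' i'
  rw [← hF] at h2 ⊢
  set F : Fin n → Amb n := fun b => M.vert (facet K i b) with hFdef
  by_contra hcon
  have hpos : 0 < homDet (Fin.cons (M.vert (K i)) F) * homDet (Fin.cons (M.vert (K' i')) F) :=
    lt_of_le_of_ne (not_lt.1 hcon) (mul_ne_zero h1 h2).symm
  have hn0 : (n : ℝ) ≠ 0 := Nat.cast_ne_zero.2 hn.ne'
  have hninv : 0 < (n : ℝ)⁻¹ := by positivity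
  -- barycentric coordinates of the vertex of `K` with respect to `K'`
  obtain ⟨w, hw1, hwv⟩ := exists_barycentric h2 (M.vert (K i))
  have hw0 : 0 < w 0 := by
    have h := homDet_cons_affine F Finset.univ w (Fin.cons (M.vert (K' i')) F) hw1
    rw [hwv, Fin.sum_univ_succ] at h
    simp only [Fin.cons_zero, Fin.cons_succ, homDet_cons_self, mul_zero,
      Finset.sum_const_zero, add_zero] at h
    rw [h] at hpos
    by_contra hc
    nlinarith [mul_self_nonneg (homDet (Fin.cons (M.vert (K' i')) F))]
  -- a small step from the barycenter of the facet towards that vertex stays in `K'`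
  have hev : ∀ᶠ ε : ℝ in nhdsWithin 0 (Set.Ioi 0),
      (∀ b : Fin n, 0 < (1 - ε) * (n : ℝ)⁻¹ + ε * w b.succ) ∧ ε < 1 ∧ 0 < ε := by
    refine Filter.Eventually.and (Filter.eventually_all.2 fun b => ?_) (Filter.Eventually.and ?_ ?_)
    · have : Filter.Tendsto (fun ε : ℝ => (1 - ε) * (n : ℝ)⁻¹ + ε * w b.succ) (nhds 0)
          (nhds ((1 - 0) * (n : ℝ)⁻¹ + 0 * w b.succ)) :=
        Continuous.tendsto (by fun_prop) 0
      exact nhdsWithin_le_nhds (this.eventually (lt_mem_nhds (by simpa using hn)))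
    · exact nhdsWithin_le_nhds (gt_mem_nhds one_pos)
    · exact self_mem_nhdsWithin
  obtain ⟨ε, hεb, hε1, hε0⟩ := hev.exists
  set x : Amb n := (1 - ε) • (∑ b, (n : ℝ)⁻¹ • F b) + ε • M.vert (K i) with hx
  have hsumn : ∑ _b : Fin n, (n : ℝ)⁻¹ = 1 := by simp [hn0]
  have hFK : ∀ b, F b ∈ M.vert '' Set.range K := fun b => ⟨_, ⟨i.succAbove b, rfl⟩, rfl⟩
  have hFK' : ∀ b, F b ∈ M.vert '' Set.range K' := by
    intro b
    simp only [hFdef, hF]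
    exact ⟨_, ⟨i'.succAbove b, rfl⟩, rfl⟩
  have hxK : x ∈ convexHull ℝ (M.vert '' Set.range K) := by
    refine (convex_convexHull ℝ _) ?_
      (subset_convexHull ℝ _ (Set.mem_image_of_mem _ (Set.mem_range_self i)))
      (by linarith) hε0.le (by ring)
    exact (convex_convexHull ℝ _).sum_mem (fun _ _ => hninv.le) hsumn
      fun b _ => subset_convexHull ℝ _ (hFK b)
  have hxK' : x ∈ convexHull ℝ (M.vert '' Set.range K') := by
    have hx' : x = ∑ a : Fin (n + 1), (Fin.cons (ε * w 0)
        (fun b => (1 - ε) * (n : ℝ)⁻¹ + ε * w b.succ) : Fin (n + 1) → ℝ) a •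
          (Fin.cons (M.vert (K' i')) F : Fin (n + 1) → Amb n) a := by
      rw [hx, ← hwv, Fin.sum_univ_succ, Fin.sum_univ_succ]
      simp only [Fin.cons_zero, Fin.cons_succ, smul_add, add_smul, Finset.sum_add_distrib,
        Finset.smul_sum, smul_smul]
      abel
    rw [hx']
    refine (convex_convexHull ℝ _).sum_mem (fun a _ => ?_) ?_ (fun a _ => ?_)
    · refine Fin.cases ?_ (fun b => ?_) a
      · exact (mul_pos hε0 hw0).le
      · exact (hεb b).le
    · rw [Fin.sum_univ_succ] at hw1 ⊢
      simp only [Fin.cons_zero, Fin.cons_succ, Finset.sum_add_distrib, ← Finset.mul_sum, hsumn]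
      linear_combination ε * hw1
    · refine Fin.cases ?_ (fun b => ?_) a
      · exact subset_convexHull ℝ _ (Set.mem_image_of_mem _ (Set.mem_range_self i'))
      · exact subset_convexHull ℝ _ (hFK' b)
  have hcommon : convexHull ℝ (M.vert '' (Set.range K ∩ Set.range K')) ⊆
      {y | homDet (Fin.cons y F) = 0} := by
    refine convexHull_min ?_ ?_
    · rintro _ ⟨k, ⟨⟨a, rfl⟩, ⟨a', ha'⟩⟩, rfl⟩
      rcases mem_range_facet_or K i a with rfl | ⟨b, hb⟩
      · rcases mem_range_facet_or K' i' a' with rfl | ⟨b, hb⟩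
        · exact absurd (eq_of_facet_eq hF ha'.symm) hne
        · rw [ha', ← hF] at hb
          exact absurd hb (apply_ne_facet K a b)
      · rw [hb]
        exact homDet_cons_self F b
    · intro y hy z hz a b _ _ hab
      have h := homDet_cons_affine F Finset.univ ![a, b] ![y, z] (by simpa using hab)
      simp only [Fin.sum_univ_two, Matrix.cons_val_zero, Matrix.cons_val_one] at h
      rw [Set.mem_ofPred_eq] at hy hz ⊢
      rw [h, hy, hz]; ring
  have hLx : homDet (Fin.cons x F) = 0 := hcommon (M.conforming K hK K' hK' ⟨hxK, hxK'⟩)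
  have h := homDet_cons_affine F Finset.univ ![1 - ε, ε] ![∑ b, (n : ℝ)⁻¹ • F b, M.vert (K i)]
    (by simp)
  simp only [Fin.sum_univ_two, Matrix.cons_val_zero, Matrix.cons_val_one] at h
  rw [← hx, hLx, homDet_cons_affine F Finset.univ _ _ hsumn] at h
  simp only [homDet_cons_self, mul_zero, Finset.sum_const_zero, zero_add] at h
  exact mul_ne_zero hε0.ne' h1 h.symm

theorem elemSign_opposite (hn : 0 < n) {K K' : Fin (n + 1) ↪o ι} (hK : K ∈ M.elems)
    (hK' : K' ∈ M.elems) {i i' : Fin (n + 1)} (hF : facet K i = facet K' i')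
    (hne : (K, i) ≠ (K', i')) :
    M.elemSign K * (-1) ^ (i : ℕ) = -(M.elemSign K' * (-1) ^ (i' : ℕ)) := by
  rw [elemSign_mul_neg_one_pow, elemSign_mul_neg_one_pow]
  rcases mul_neg_iff.1 (homDet_mul_neg M hn hK hK' hF hne) with ⟨h, h'⟩ | ⟨h, h'⟩
  · rw [Real.sign_of_pos h, Real.sign_of_neg h']; norm_num
  · rw [Real.sign_of_pos h', Real.sign_of_neg h]

theorem mem_sides {F : Fin n ↪o ι} {S : (Fin (n + 1) ↪o ι) × Fin (n + 1)} :
    S ∈ M.sides F ↔ S.1 ∈ M.elems ∧ facet S.1 S.2 = F := by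
  simp [Mesh.sides]

/-- An internal face has no other sides than the left and the right one: of three elements
sharing a facet, two would lie on the same side of it. -/
theorem sides_eq_pair (hn : 0 < n) (LR : M.LeftRight) {F : Fin n ↪o ι}
    (hF : F ∈ M.internalFaces) : M.sides F = {LR.left F, LR.right F} := by
  classical
  obtain ⟨hL, hLF⟩ := (mem_sides M).1 (LR.left_mem F hF)
  obtain ⟨hR, hRF⟩ := (mem_sides M).1 (LR.right_mem F hF)
  ext S
  rw [Finset.mem_insert, Finset.mem_singleton]
  constructor
  · intro hS
    by_contra hcon
    rw [not_or] at hcon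
    obtain ⟨hSe, hSF⟩ := (mem_sides M).1 hS
    have h1 := homDet_mul_neg M hn hSe hL (hSF.trans hLF.symm) hcon.1
    have h2 := homDet_mul_neg M hn hSe hR (hSF.trans hRF.symm) hcon.2
    have h3 := homDet_mul_neg M hn hL hR (hLF.trans hRF.symm) (LR.left_ne_right F hF)
    rcases mul_neg_iff.1 h1 with ⟨a, b⟩ | ⟨a, b⟩ <;>
      rcases mul_neg_iff.1 h2 with ⟨c, d⟩ | ⟨c, d⟩ <;>
      rcases mul_neg_iff.1 h3 with ⟨e, f⟩ | ⟨e, f⟩ <;> linarith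
  · rintro (rfl | rfl)
    · exact LR.left_mem F hF
    · exact LR.right_mem F hF

end Orientation

/-! ### The bilinear pairing on a face -/

section FaceSign

variable {n m : ℕ}

open Classical in
/-- The part of the orientation of a subsimplex `γ` of a face that does not depend on the element
from which the face is seen. -/
def faceSign (γ : Fin m ↪o Fin n) : ℝ :=
  (-1) ^ ((Finset.univ.filter fun cd : Fin n × Fin n =>
      cd.1 ∉ Set.range γ ∧ cd.2 ∈ Set.range γ ∧ cd.2 < cd.1).card +
    (Finset.univ.filter fun c : Fin n => c ∉ Set.range γ).card)

open Classical in
theorem card_inversions_insertVertex (i : Fin (n + 1)) (γ : Fin m ↪o Fin n) :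
    (Finset.univ.filter fun ab : Fin (n + 1) × Fin (n + 1) =>
      ab.1 ∉ Set.range (insertVertex i γ) ∧ ab.2 ∈ Set.range (insertVertex i γ) ∧
        ab.2 < ab.1).card =
    (Finset.univ.filter fun cd : Fin n × Fin n =>
      cd.1 ∉ Set.range γ ∧ cd.2 ∈ Set.range γ ∧ cd.2 < cd.1).card +
    (Finset.univ.filter fun c : Fin n => c ∉ Set.range γ ∧ ¬ i.succAbove c < i).card := by
  have hi : i ∈ Set.range (insertVertex i γ) := by
    rw [range_insertVertex]; exact Set.mem_insert _ _
  have hc : ∀ c, i.succAbove c ∈ Set.range (insertVertex i γ) ↔ c ∈ Set.range γ := by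
    intro c
    rw [range_insertVertex]
    simp [Fin.succAbove_ne]
  have hlt : ∀ c, i < i.succAbove c ↔ ¬ i.succAbove c < i := fun c =>
    ⟨fun h => h.asymm, fun h => lt_of_le_of_ne (not_lt.1 h) (Fin.succAbove_ne i c).symm⟩
  simp only [Finset.card_filter, Fintype.sum_prod_type]
  rw [Fin.sum_univ_succAbove _ i]
  simp only [Fin.sum_univ_succAbove _ i, hi, hc, hlt, (Fin.strictMono_succAbove i).lt_iff_lt]
  simp [Finset.sum_add_distrib, add_comm]

open Classical in
theorem card_succAbove_lt (i : Fin (n + 1)) (γ : Fin m ↪o Fin n) :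
    (Finset.univ.filter fun c : Fin n => c ∉ Set.range γ ∧ i.succAbove c < i).card +
      (insertPos i γ : ℕ) = i := by
  have h1 : (insertPos i γ : ℕ) =
      (Finset.univ.filter fun c : Fin n => c ∈ Set.range γ ∧ i.succAbove c < i).card := by
    change (Finset.univ.filter fun b : Fin m => i.succAbove (γ b) < i).card = _
    rw [← Finset.card_map γ.toEmbedding]
    congr 1
    ext c
    simp only [Finset.mem_map, Finset.mem_filter, Finset.mem_univ, true_and, Set.mem_range]
    constructor
    · rintro ⟨b, hb, rfl⟩
      exact ⟨⟨b, rfl⟩, hb⟩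
    · rintro ⟨⟨b, rfl⟩, hb⟩
      exact ⟨b, hb, rfl⟩
  have h2 : (Finset.univ.filter fun c : Fin n => i.succAbove c < i).card = i := by
    have : (Finset.univ.filter fun c : Fin n => i.succAbove c < i) =
        Finset.univ.filter fun c : Fin n => (c : ℕ) < i := by
      ext c
      simp only [Fin.succAbove_lt_iff_castSucc_lt]
      rfl
    have hi := i.2
    rw [this]
    simp [Fin.card_filter_val_lt]
    omega
  conv_rhs => rw [← h2, ← Finset.card_filter_add_card_filter_not
    (s := Finset.univ.filter fun c : Fin n => i.succAbove c < i) (fun c => c ∈ Set.range γ),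
    Finset.filter_filter, Finset.filter_filter]
  rw [h1, add_comm]
  simp only [and_comm]

/-- The orientation factor of a subsimplex of a face splits into a factor of the element and a
factor of the face. -/
theorem subSign_mul_neg_one_pow {ι : Type*} [LinearOrder ι] (M : Mesh n ι) (K : Fin (n + 1) ↪o ι)
    (i : Fin (n + 1)) (γ : Fin m ↪o Fin n) :
    M.subSign K (insertVertex i γ) * (-1) ^ (insertPos i γ : ℕ) =
      M.elemSign K * (-1) ^ (i : ℕ) * faceSign γ := by
  classical
  have h2 := card_succAbove_lt i γ
  have h3 := Finset.card_filter_add_card_filter_not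
    (s := Finset.univ.filter fun c : Fin n => c ∉ Set.range γ) (fun c => i.succAbove c < i)
  rw [Finset.filter_filter, Finset.filter_filter] at h3
  rw [Mesh.subSign, card_inversions_insertVertex, faceSign, ← h3]
  conv_rhs => rw [← h2]
  simp only [mul_assoc, ← pow_add]
  congr 1
  set X := (Finset.univ.filter fun c : Fin n => c ∉ Set.range γ ∧ i.succAbove c < i).card
  -- the exponents differ by `2 X`
  rw [show ∀ p q z : ℕ, X + z + (p + (X + q)) = p + q + z + 2 * X from fun _ _ _ => by ring,
    pow_add _ _ (2 * X), pow_mul]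
  simp

end FaceSign

section FaceForm

variable {n s : ℕ} (r : ℕ)

/-- The pairing on a face with the orientation factor of the element removed. -/
def faceForm (a : BdQ n s) (b : BdP n s) : ℝ :=
  ∑ j ∈ Finset.range r, ∑ γ : Fin (s + j + 1) ↪o Fin n,
    faceSign γ * wedgeInt rfl (a j γ) (b j γ)

theorem pairFace_eq {ι : Type*} [LinearOrder ι] (M : Mesh n ι) (K : Fin (n + 1) ↪o ι)
    (i : Fin (n + 1)) (a : BdQ n s) (b : BdP n s) :
    pairFace M r K i a b = M.elemSign K * (-1) ^ (i : ℕ) * faceForm r a b := by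
  simp only [pairFace, faceForm, Finset.mul_sum, subSign_mul_neg_one_pow, mul_assoc]

theorem wedgeInt_add_left {a b m : ℕ} (h : a + b = m) {α α' : DForm (Ref m) a}
    {β : DForm (Ref m) b} (hα : Continuous α) (hα' : Continuous α') (hβ : Continuous β) :
    wedgeInt h (α + α') β = wedgeInt h α β + wedgeInt h α' β := by
  simp only [wedgeInt, Pi.add_apply, wedgeEval_add_left]
  exact integral_add (integrableOn_refSimplex (continuous_wedgeEval h hα hβ _))
    (integrableOn_refSimplex (continuous_wedgeEval h hα' hβ _))

theorem wedgeInt_add_right {a b m : ℕ} (h : a + b = m) {α : DForm (Ref m) a}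
    {β β' : DForm (Ref m) b} (hα : Continuous α) (hβ : Continuous β) (hβ' : Continuous β') :
    wedgeInt h α (β + β') = wedgeInt h α β + wedgeInt h α β' := by
  simp only [wedgeInt, Pi.add_apply, wedgeEval_add_right]
  exact integral_add (integrableOn_refSimplex (continuous_wedgeEval h hα hβ _))
    (integrableOn_refSimplex (continuous_wedgeEval h hα hβ' _))

theorem wedgeInt_smul_left {a b m : ℕ} (h : a + b = m) (c : ℝ) (α : DForm (Ref m) a)
    (β : DForm (Ref m) b) : wedgeInt h (c • α) β = c * wedgeInt h α β := by
  simp only [wedgeInt, Pi.smul_apply, wedgeEval_smul_left, integral_const_mul]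

theorem wedgeInt_smul_right {a b m : ℕ} (h : a + b = m) (c : ℝ) (α : DForm (Ref m) a)
    (β : DForm (Ref m) b) : wedgeInt h α (c • β) = c * wedgeInt h α β := by
  simp only [wedgeInt, Pi.smul_apply, wedgeEval_smul_right, integral_const_mul]

/-- The boundary variables in `E_q` with continuous entries in the range of the pairing. -/
def contBdQ (n s r : ℕ) : Submodule ℝ (BdQ n s) where
  carrier := {a | ∀ j < r, ∀ γ, Continuous (a j γ)}
  zero_mem' := fun _ _ _ => continuous_zero
  add_mem' ha hb j hj γ := (ha j hj γ).add (hb j hj γ)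
  smul_mem' c _ ha j hj γ := (ha j hj γ).const_smul c

/-- The boundary variables in `E_p` with continuous entries in the range of the pairing. -/
def contBdP (n s r : ℕ) : Submodule ℝ (BdP n s) where
  carrier := {a | ∀ j < r, ∀ γ, Continuous (a j γ)}
  zero_mem' := fun _ _ _ => continuous_zero
  add_mem' ha hb j hj γ := (ha j hj γ).add (hb j hj γ)
  smul_mem' c _ ha j hj γ := (ha j hj γ).const_smul c

variable {r}

theorem faceForm_add_left {a a' : BdQ n s} {b : BdP n s} (ha : a ∈ contBdQ n s r)
    (ha' : a' ∈ contBdQ n s r) (hb : b ∈ contBdP n s r) :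
    faceForm r (a + a') b = faceForm r a b + faceForm r a' b := by
  simp only [faceForm, ← Finset.sum_add_distrib]
  refine Finset.sum_congr rfl fun j hj => Finset.sum_congr rfl fun γ _ => ?_
  have hj := Finset.mem_range.1 hj
  rw [Pi.add_apply, Pi.add_apply, wedgeInt_add_left _ (ha j hj γ) (ha' j hj γ) (hb j hj γ), mul_add]

theorem faceForm_add_right {a : BdQ n s} {b b' : BdP n s} (ha : a ∈ contBdQ n s r)
    (hb : b ∈ contBdP n s r) (hb' : b' ∈ contBdP n s r) :
    faceForm r a (b + b') = faceForm r a b + faceForm r a b' := by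
  simp only [faceForm, ← Finset.sum_add_distrib]
  refine Finset.sum_congr rfl fun j hj => Finset.sum_congr rfl fun γ _ => ?_
  have hj := Finset.mem_range.1 hj
  rw [Pi.add_apply, Pi.add_apply, wedgeInt_add_right _ (ha j hj γ) (hb j hj γ) (hb' j hj γ),
    mul_add]

variable (r) in
theorem faceForm_smul_left (c : ℝ) (a : BdQ n s) (b : BdP n s) :
    faceForm r (c • a) b = c * faceForm r a b := by
  simp only [faceForm, Finset.mul_sum]
  refine Finset.sum_congr rfl fun j _ => Finset.sum_congr rfl fun γ _ => ?_
  rw [Pi.smul_apply, Pi.smul_apply, wedgeInt_smul_left]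
  ring

variable (r) in
theorem faceForm_smul_right (c : ℝ) (a : BdQ n s) (b : BdP n s) :
    faceForm r a (c • b) = c * faceForm r a b := by
  simp only [faceForm, Finset.mul_sum]
  refine Finset.sum_congr rfl fun j _ => Finset.sum_congr rfl fun γ _ => ?_
  rw [Pi.smul_apply, Pi.smul_apply, wedgeInt_smul_right]
  ring

end FaceForm

/-! ### Regularity of the discrete spaces -/

section Smooth

/-- In finite dimension, a form is smooth as soon as its coefficients are. -/
theorem contDiff_of_apply {V : Type*} [NormedAddCommGroup V] [NormedSpace ℝ V]
    [FiniteDimensional ℝ V] {k : ℕ} {ω : DForm V k} {N : WithTop ℕ∞}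
    (h : ∀ v : Fin k → V, ContDiff ℝ N (fun x => ω x v)) : ContDiff ℝ N ω := by
  set b := Module.finBasis ℝ V
  let L : (V [⋀^Fin k]→L[ℝ] ℝ) →ₗ[ℝ] (Fin k → Fin (Module.finrank ℝ V)) → ℝ :=
    { toFun := fun α I => α fun l => b (I l)
      map_add' := fun _ _ => rfl
      map_smul' := fun _ _ => rfl }
  have hL : Function.Injective L := by
    intro α β hαβ
    apply ContinuousAlternatingMap.toAlternatingMap_injective
    exact Module.Basis.ext_alternating b fun v _ => congrFun hαβ v
  obtain ⟨G, hG⟩ := L.exists_leftInverse_of_injective (LinearMap.ker_eq_bot.2 hL)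
  have hω : ω = fun x => G.toContinuousLinearMap (fun I => ω x fun l => b (I l)) := by
    funext x
    exact (LinearMap.congr_fun hG (ω x)).symm
  rw [hω]
  exact G.toContinuousLinearMap.contDiff.comp (contDiff_pi.2 fun I => h _)

theorem contDiff_eval {n : ℕ} (P : MvPolynomial (Fin n) ℝ) {N : WithTop ℕ∞} :
    ContDiff ℝ N fun x : Amb n => MvPolynomial.eval (fun i => x i) P := by
  induction P using MvPolynomial.induction_on with
  | C a => simpa using contDiff_const
  | add p q hp hq => simpa using hp.add hq
  | mul_X p i hp =>
    simp only [map_mul, MvPolynomial.eval_X]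
    exact hp.mul (contDiff_piLp_apply 2)

theorem contDiff_of_mem_polyForms {n r k : ℕ} {ω : DForm (Amb n) k} (h : ω ∈ polyForms n r k)
    {N : WithTop ℕ∞} : ContDiff ℝ N ω := by
  refine contDiff_of_apply fun v => ?_
  obtain ⟨P, -, hP⟩ := h v
  simp only [hP]
  exact contDiff_eval P

theorem polyForms_mono {n r r' k : ℕ} (h : r ≤ r') : polyForms n r k ≤ polyForms n r' k :=
  fun _ hω v => let ⟨P, hP, hP'⟩ := hω v; ⟨P, hP.trans h, hP'⟩

theorem trimmedForms_le {n r k : ℕ} : trimmedForms n r k ≤ polyForms n r k := by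
  cases r with
  | zero => exact bot_le
  | succ r =>
    refine sup_le (polyForms_mono (Nat.le_succ r)) ?_
    rintro _ ⟨ω, hω, rfl⟩ v
    choose P hP hP' using fun i : Fin n => hω (Matrix.vecCons (EuclideanSpace.single i 1) v)
    refine ⟨∑ i, MvPolynomial.X i * P i, ?_, fun x => ?_⟩
    · refine MvPolynomial.totalDegree_finsetSum_le fun i _ => ?_
      refine (MvPolynomial.totalDegree_mul _ _).trans ?_
      rw [MvPolynomial.totalDegree_X, add_comm]
      exact Nat.add_le_add_right (hP i).totalDegree_le 1
    · have hx : x = ∑ i, x i • EuclideanSpace.single i (1 : ℝ) := by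
        ext j; simp [Finset.sum_apply, Pi.single_apply]
      have h : ∀ f : Amb n [⋀^Fin (k + 1)]→L[ℝ] ℝ, f.curryLeft x v =
          ∑ i, x i * f (Matrix.vecCons (EuclideanSpace.single i 1) v) := by
        intro f
        conv_lhs => rw [hx, map_sum]
        simp
      change (ω x).curryLeft x v = _
      rw [h, map_sum]
      simp [hP']

theorem EqSpace_le {n s r : ℕ} (c : Family) : EqSpace n s r c ≤ polyForms n (r + 1) s := by
  cases c with
  | full => exact le_rfl
  | trimmed => exact trimmedForms_le.trans (polyForms_mono (Nat.le_succ r))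

theorem EpForms_le {n r j : ℕ} (c : Family) : EpForms n r j c ≤ polyForms n r j := by
  cases c with
  | full => exact trimmedForms_le.trans (polyForms_mono (Nat.sub_le _ _))
  | trimmed => exact polyForms_mono ((Nat.sub_le _ _).trans (Nat.sub_le _ _))

variable {n : ℕ} {ι : Type*} [LinearOrder ι] {M : Mesh n ι} {s r : ℕ} {c : Family}

theorem MemEp.contDiff {K : Fin (n + 1) ↪o ι} {e : EpVec n s} (he : MemEp M r c K e) (j : ℕ)
    (φ : Fin (s + j + 2) ↪o Fin (n + 1)) {N : WithTop ℕ∞} : ContDiff ℝ N (e j φ) := by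
  rcases lt_or_ge j r with hj | hj
  · obtain ⟨ω, hω, h⟩ := (he j φ).1 hj
    rw [← h]
    exact contDiff_tr _ (contDiff_of_mem_polyForms (EpForms_le c hω))
  · rw [(he j φ).2 hj]
    exact contDiff_const

theorem trp_mem_contBdP {K : Fin (n + 1) ↪o ι} {e : EpVec n s} (he : MemEp M r c K e)
    (i : Fin (n + 1)) : trp i e ∈ contBdP n s r :=
  fun _ _ _ => (contDiff_tr (N := 0) _ (he.contDiff _ _)).continuous

theorem trq_mem_contBdQ {e : DForm (Amb n) s} (he : e ∈ EqSpace n s r c) (K : Fin (n + 1) ↪o ι)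
    (i : Fin (n + 1)) : trq M K i e ∈ contBdQ n s r :=
  fun _ _ _ => (contDiff_tr (N := 0) _ (contDiff_of_mem_polyForms (EqSpace_le c he))).continuous

theorem MemBdP.mem_contBdP {F : Fin n ↪o ι} {b : BdP n s} (hb : MemBdP M r c F b) :
    b ∈ contBdP n s r := by
  intro j hj γ
  obtain ⟨ω, hω, h⟩ := hb j hj γ
  rw [← h]
  exact (contDiff_tr (N := 0) _ (contDiff_of_mem_polyForms (EpForms_le c hω))).continuous

theorem MemBdQ.mem_contBdQ {F : Fin n ↪o ι} {b : BdQ n s} (hb : MemBdQ M r c F b) :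
    b ∈ contBdQ n s r := by
  intro j hj γ
  obtain ⟨ω, hω, h⟩ := hb j hj γ
  rw [← h]
  exact (contDiff_tr (N := 0) _ (contDiff_of_mem_polyForms (EqSpace_le c hω))).continuous

end Smooth

/-! ### Time derivatives in finite-dimensional function spaces -/

section TimeDerivative

/-- A finite-dimensional space of functions is interpolated by finitely many points: the
point evaluations separate its elements, hence they span the dual space, and finitely many of them
suffice for this. -/
theorem exists_interpolation {X : Type*} (W : Submodule ℝ (X → ℝ)) [FiniteDimensional ℝ W] :
    ∃ (N : ℕ) (x : Fin N → X) (φ : Fin N → X → ℝ), (∀ i, φ i ∈ W) ∧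
      ∀ f ∈ W, f = ∑ i, f (x i) • φ i := by
  let ev : X → Module.Dual ℝ W := fun x => (LinearMap.proj x).comp W.subtype
  have hspan : Submodule.span ℝ (Set.range ev) = ⊤ := by
    have h0 : (Submodule.span ℝ (Set.range ev)).dualCoannihilator = ⊥ := by
      rw [eq_bot_iff]
      intro f hf
      rw [Submodule.mem_dualCoannihilator] at hf
      exact Subtype.ext (funext fun x => hf _ (Submodule.subset_span ⟨x, rfl⟩))
    rw [← Subspace.dualCoannihilator_dualAnnihilator_eq (W := Submodule.span ℝ (Set.range ev)), h0]
    simp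
  obtain ⟨t, ht, hspan'⟩ := Submodule.fg_span_iff_fg_span_finset_subset (R := ℝ) (Set.range ev) |>.1
    (by rw [hspan]; exact Module.Finite.fg_top)
  classical
  choose y hy using fun l : t => ht l.2
  let L : W →ₗ[ℝ] (t → ℝ) := LinearMap.pi fun l => ev (y l)
  have hL : LinearMap.ker L = ⊥ := by
    rw [eq_bot_iff]
    intro f hf
    have h1 : Submodule.span ℝ (t : Set (Module.Dual ℝ W)) ≤
        LinearMap.ker (Module.Dual.eval ℝ W f) := by
      rw [Submodule.span_le]
      intro l hl
      have := congrFun (LinearMap.mem_ker.1 hf) ⟨l, hl⟩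
      simp only [L, LinearMap.pi_apply, hy] at this
      exact this
    refine Subtype.ext (funext fun x => ?_)
    exact h1 (by rw [← hspan', hspan]; trivial : ev x ∈ _)
  obtain ⟨G, hG⟩ := L.exists_leftInverse_of_injective hL
  let e := t.equivFin
  refine ⟨t.card, fun i => y (e.symm i), fun i => G (Pi.single (e.symm i) 1),
    fun i => (G _).2, fun f hf => ?_⟩
  have h1 : (⟨f, hf⟩ : W) = G (L ⟨f, hf⟩) := (LinearMap.congr_fun hG _).symm
  have h2 : L ⟨f, hf⟩ = ∑ l : t, f (y l) • Pi.single l (1 : ℝ) := by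
    ext l
    simp [L, ev, Pi.single_apply]
  rw [h2, map_sum] at h1
  have h3 := congrArg Subtype.val h1
  simp only [map_smul, Submodule.coe_sum, Submodule.coe_smul] at h3
  conv_lhs => rw [h3, ← Equiv.sum_comp e.symm]

/-- Weighted `L²` products of curves in a finite-dimensional space of continuous functions may be
differentiated under the integral, pointwise derivatives being sufficient. -/
theorem hasDerivWithinAt_integral_mul {X : Type*} [TopologicalSpace X] [T2Space X]
    [MeasurableSpace X] [BorelSpace X] {μ : Measure X} {S : Set X} (hS : IsCompact S) {C : X → ℝ}
    (hC : IntegrableOn C S μ)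
    (W : Submodule ℝ (X → ℝ)) [FiniteDimensional ℝ W] (hW : ∀ f ∈ W, Continuous f)
    {I : Set ℝ} {t : ℝ} (ht : t ∈ I) {a b : ℝ → X → ℝ} {a' b' : X → ℝ}
    (ha : ∀ τ ∈ I, a τ ∈ W) (hb : ∀ τ ∈ I, b τ ∈ W) (ha'W : a' ∈ W) (hb'W : b' ∈ W)
    (ha' : ∀ x, HasDerivWithinAt (fun τ => a τ x) (a' x) I t)
    (hb' : ∀ x, HasDerivWithinAt (fun τ => b τ x) (b' x) I t) :
    HasDerivWithinAt (fun τ => ∫ x in S, a τ x * b τ x * C x ∂μ)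
      ((∫ x in S, a' x * b t x * C x ∂μ) + ∫ x in S, a t x * b' x * C x ∂μ) I t := by
  obtain ⟨N, y, φ, hφ, hrep⟩ := exists_interpolation W
  have hint : ∀ i j, IntegrableOn (fun x => φ i x * φ j x * C x) S μ := fun i j =>
    hC.continuousOn_mul ((hW _ (hφ i)).mul (hW _ (hφ j))).continuousOn hS
  have key : ∀ f ∈ W, ∀ g ∈ W, ∫ x in S, f x * g x * C x ∂μ =
      ∑ i, ∑ j, f (y i) * g (y j) * ∫ x in S, φ i x * φ j x * C x ∂μ := by
    intro f hf g hg
    have h1 : ∀ x, f x * g x * C x =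
        ∑ i, ∑ j, f (y i) * g (y j) * (φ i x * φ j x * C x) := by
      intro x
      have hfx := congrFun (hrep f hf) x
      have hgx := congrFun (hrep g hg) x
      simp only [Finset.sum_apply, Pi.smul_apply, smul_eq_mul] at hfx hgx
      conv_lhs => rw [hfx, hgx, Finset.sum_mul_sum, Finset.sum_mul]
      refine Finset.sum_congr rfl fun i _ => ?_
      rw [Finset.sum_mul]
      exact Finset.sum_congr rfl fun j _ => by ring
    simp only [h1]
    rw [integral_finsetSum _ fun i _ => integrable_finsetSum _ fun j _ => (hint i j).const_mul _]
    refine Finset.sum_congr rfl fun i _ => ?_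
    rw [integral_finsetSum _ fun j _ => (hint i j).const_mul _]
    exact Finset.sum_congr rfl fun j _ => integral_const_mul _ _
  have hder : HasDerivWithinAt
      (fun τ => ∑ i, ∑ j, a τ (y i) * b τ (y j) * ∫ x in S, φ i x * φ j x * C x ∂μ)
      (∑ i, ∑ j, (a' (y i) * b t (y j) + a t (y i) * b' (y j)) *
        ∫ x in S, φ i x * φ j x * C x ∂μ) I t :=
    HasDerivWithinAt.fun_sum fun i _ => HasDerivWithinAt.fun_sum fun j _ =>
      ((ha' (y i)).mul (hb' (y j))).mul_const _
  refine (hder.congr (fun τ hτ => key _ (ha τ hτ) _ (hb τ hτ))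
    (key _ (ha t ht) _ (hb t ht))).congr_deriv ?_
  rw [key _ ha'W _ (hb t ht), key _ (ha t ht) _ hb'W]
  simp only [add_mul, Finset.sum_add_distrib]

end TimeDerivative

/-! ### The time derivative of the energy -/

section Energy

/-- The polynomial functions of degree at most `R` on `ℝⁿ`. -/
def polyFun (n R : ℕ) : Submodule ℝ (Amb n → ℝ) :=
  (MvPolynomial.restrictTotalDegree (Fin n) ℝ R).map
    (LinearMap.pi fun x : Amb n => (MvPolynomial.aeval fun i => x i).toLinearMap)

instance finiteDimensional_polyFun (n R : ℕ) : FiniteDimensional ℝ (polyFun n R) := by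
  have : Module.Finite ℝ (MvPolynomial.restrictTotalDegree (Fin n) ℝ R) := by
    have hfin : {d : Fin n →₀ ℕ | (d.sum fun _ e => e) ≤ R}.Finite := by
      refine (Set.finite_Iic (Finsupp.equivFunOnFinite.symm fun _ => R)).subset ?_
      intro d hd i
      rw [Set.mem_ofPred_eq, Finsupp.sum_fintype _ _ (fun _ => rfl)] at hd
      exact (Finset.single_le_sum (fun _ _ => Nat.zero_le _) (Finset.mem_univ i)).trans hd
    have := hfin.to_subtype
    exact Module.Finite.of_basis (MvPolynomial.basisRestrictSupport ℝ _)
  unfold polyFun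
  infer_instance

theorem apply_mem_polyFun {n R k : ℕ} {ω : DForm (Amb n) k} (hω : ω ∈ polyForms n R k)
    (v : Fin k → Amb n) : (fun x => ω x v) ∈ polyFun n R := by
  obtain ⟨P, hP, h⟩ := hω v
  refine ⟨P, (MvPolynomial.mem_restrictTotalDegree _ _ _).2 hP, funext fun x => ?_⟩
  rw [h]
  rfl

theorem continuous_of_mem_polyFun {n R : ℕ} {f : Amb n → ℝ} (hf : f ∈ polyFun n R) :
    Continuous f := by
  obtain ⟨P, -, rfl⟩ := hf
  exact (contDiff_eval P (N := 0)).continuous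

variable {n m k : ℕ}

theorem isSymm_gram (w : Fin (m + 1) → Amb n) : (gram w).IsSymm := by
  ext i j
  exact real_inner_comm (w i.succ - w 0) (w j.succ - w 0)

theorem covectorInner_comm (w : Fin (m + 1) → Amb n) (a b : Ref m [⋀^Fin k]→L[ℝ] ℝ) :
    covectorInner w a b = covectorInner w b a := by
  have hs : ∀ i j, (gram w)⁻¹ i j = (gram w)⁻¹ j i := fun i j => (isSymm_gram w).inv.apply j i
  simp only [covectorInner]
  rw [Finset.sum_comm]
  congr 1
  refine Finset.sum_congr rfl fun I _ => Finset.sum_congr rfl fun J _ => ?_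
  rw [Finset.prod_congr rfl fun l _ => hs (J l) (I l)]
  ring

theorem weightedInt_comm (w : Fin (m + 1) → Amb n) (C : Amb n → ℝ) (a b : DForm (Ref m) k) :
    weightedInt w C a b = weightedInt w C b a := by
  simp only [weightedInt, covectorInner_comm w (a _)]

theorem weightedInt_eq_sum (w : Fin (m + 1) → Amb n) {C : Amb n → ℝ}
    (hC : IntegrableOn (fun t => C (param w t)) (refSimplex m)) {a b : DForm (Ref m) k}
    (ha : Continuous a) (hb : Continuous b) :
    weightedInt w C a b = ∑ I : Fin k → Fin m, ∑ J : Fin k → Fin m,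
      (k.factorial : ℝ)⁻¹ * (∏ l, (gram w)⁻¹ (I l) (J l)) * Real.sqrt (gram w).det *
        ∫ t in refSimplex m, a t (fun l => Pi.single (I l) 1) * b t (fun l => Pi.single (J l) 1) *
          C (param w t) := by
  have hev : ∀ {f : DForm (Ref m) k}, Continuous f → ∀ v, Continuous fun t => f t v :=
    fun hf v => (contDiff_form_apply (contDiff_zero.2 hf) v).continuous
  have hint : ∀ (c : ℝ) (I J : Fin k → Fin m), IntegrableOn (fun t => c *
      (a t (fun l => Pi.single (I l) 1) * b t (fun l => Pi.single (J l) 1) *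
        C (param w t))) (refSimplex m) := fun c I J =>
    (hC.continuousOn_mul ((hev ha _).mul (hev hb _)).continuousOn
      (isCompact_refSimplex m)).const_mul c
  simp only [← integral_const_mul]
  rw [weightedInt]
  simp only [← integral_finsetSum Finset.univ fun J _ => hint _ _ J]
  rw [← integral_finsetSum _ fun I _ => integrable_finsetSum _ fun J _ => hint _ I J]
  refine integral_congr_ae (Filter.Eventually.of_forall fun t => ?_)
  simp only [covectorInner, Finset.mul_sum, Finset.sum_mul]
  exact Finset.sum_congr rfl fun I _ => Finset.sum_congr rfl fun J _ => by ring

theorem hasDerivWithinAt_form_apply {V : Type*} [NormedAddCommGroup V] [NormedSpace ℝ V]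
    {a : ℝ → V [⋀^Fin k]→L[ℝ] ℝ} {a' : V [⋀^Fin k]→L[ℝ] ℝ} {I : Set ℝ} {t : ℝ}
    (h : HasDerivWithinAt a a' I t) (v : Fin k → V) :
    HasDerivWithinAt (fun τ => a τ v) (a' v) I t :=
  (ContinuousAlternatingMap.apply ℝ V ℝ v).hasFDerivAt.comp_hasDerivWithinAt t h

theorem hasDerivWithinAt_weightedInt (w : Fin (m + 1) → Amb n) {C : Amb n → ℝ}
    (hC : IntegrableOn (fun t => C (param w t)) (refSimplex m)) {R : ℕ} {I : Set ℝ} {t : ℝ}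
    (ht : t ∈ I) {a : ℝ → DForm (Ref m) k} {a' : DForm (Ref m) k}
    (ha : ∀ τ ∈ I, a τ ∈ (polyForms n R k).map (tr w)) (ha'W : a' ∈ (polyForms n R k).map (tr w))
    (ha' : ∀ x, HasDerivWithinAt (fun τ => a τ x) (a' x) I t) :
    HasDerivWithinAt (fun τ => weightedInt w C (a τ) (a τ)) (2 * weightedInt w C (a t) a') I t := by
  set W : Submodule ℝ (Ref m → ℝ) := (polyFun n R).map (LinearMap.funLeft ℝ ℝ (param w)) with hW
  have hmem : ∀ f ∈ (polyForms n R k).map (tr w), ∀ v, (fun x => f x v) ∈ W := by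
    rintro _ ⟨ω, hω, rfl⟩ v
    exact ⟨_, apply_mem_polyFun hω fun i => paramLin w (v i), rfl⟩
  have hcont : ∀ f ∈ (polyForms n R k).map (tr w), Continuous f := by
    rintro _ ⟨ω, hω, rfl⟩
    exact (contDiff_tr (N := 0) w (contDiff_of_mem_polyForms hω)).continuous
  have hWc : ∀ f ∈ W, Continuous f := by
    rintro _ ⟨f, hf, rfl⟩
    exact (continuous_of_mem_polyFun hf).comp (contDiff_param (N := 0) w).continuous
  have hder : HasDerivWithinAt (fun τ => ∑ I : Fin k → Fin m, ∑ J : Fin k → Fin m,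
      (k.factorial : ℝ)⁻¹ * (∏ l, (gram w)⁻¹ (I l) (J l)) * Real.sqrt (gram w).det *
        ∫ x in refSimplex m, a τ x (fun l => Pi.single (I l) 1) *
          a τ x (fun l => Pi.single (J l) 1) * C (param w x)) _ I t :=
    HasDerivWithinAt.fun_sum fun I' _ => HasDerivWithinAt.fun_sum fun J' _ =>
      (hasDerivWithinAt_integral_mul (isCompact_refSimplex m) hC W hWc ht
        (fun τ hτ => hmem _ (ha τ hτ) _) (fun τ hτ => hmem _ (ha τ hτ) _) (hmem _ ha'W _)
        (hmem _ ha'W _) (fun x => hasDerivWithinAt_form_apply (ha' x) _)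
        (fun x => hasDerivWithinAt_form_apply (ha' x) _)).const_mul _
  refine (hder.congr (fun τ hτ => weightedInt_eq_sum w hC (hcont _ (ha τ hτ)) (hcont _ (ha τ hτ)))
    (weightedInt_eq_sum w hC (hcont _ (ha t ht)) (hcont _ (ha t ht)))).congr_deriv ?_
  simp only [mul_add, Finset.sum_add_distrib]
  rw [← weightedInt_eq_sum w hC (hcont _ ha'W) (hcont _ (ha t ht)),
    ← weightedInt_eq_sum w hC (hcont _ (ha t ht)) (hcont _ ha'W), weightedInt_comm w C a']
  ring

variable {ι : Type*} [LinearOrder ι] {M : Mesh n ι} {s r : ℕ} {c : Family}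

theorem hasDerivWithinAt_gwp {K : Fin (n + 1) ↪o ι} {Cp : Amb n → ℝ}
    (hCp : ∀ j < r, ∀ φ : Fin (s + j + 2) ↪o Fin (n + 1),
      IntegrableOn (fun t => Cp (param (M.sub K φ) t)) (refSimplex (s + j + 1)))
    {I : Set ℝ} {t : ℝ} (ht : t ∈ I) {e : ℝ → EpVec n s} {e' : EpVec n s}
    (he : ∀ τ ∈ I, MemEp M r c K (e τ)) (he'W : MemEp M r c K e')
    (he' : ∀ j φ x, HasDerivWithinAt (fun τ => e τ j φ x) (e' j φ x) I t) :
    HasDerivWithinAt (fun τ => gwp M r Cp K (e τ) (e τ)) (2 * gwp M r Cp K (e t) e') I t := by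
  simp only [gwp, Finset.mul_sum]
  refine HasDerivWithinAt.fun_sum fun j hj => HasDerivWithinAt.fun_sum fun φ _ => ?_
  have hj := Finset.mem_range.1 hj
  have hm : ∀ f : EpVec n s, MemEp M r c K f →
      f j φ ∈ (polyForms n r j).map (tr (M.sub K φ)) :=
    fun f hf => Submodule.map_mono (EpForms_le c) ((hf j φ).1 hj)
  exact hasDerivWithinAt_weightedInt _ (hCp j hj φ) ht (fun τ hτ => hm _ (he τ hτ)) (hm _ he'W)
    (he' j φ)

theorem isCompact_element (K : Fin (n + 1) ↪o ι) :
    IsCompact (convexHull ℝ (Set.range fun a => M.vert (K a))) :=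
  (Set.finite_range _).isCompact_convexHull ℝ

theorem gwq_eq_sum (K : Fin (n + 1) ↪o ι) {Cq : Amb n → ℝ}
    (hCq : IntegrableOn Cq (convexHull ℝ (Set.range fun a => M.vert (K a))))
    {e e' : DForm (Amb n) s} (he : Continuous e) (he' : Continuous e') :
    gwq M Cq K e e' = ∑ J : Fin s ↪o Fin n,
      ∫ x in convexHull ℝ (Set.range fun a => M.vert (K a)),
        e x (fun l => EuclideanSpace.single (J l) 1) *
          e' x (fun l => EuclideanSpace.single (J l) 1) * Cq x := by
  have hev : ∀ {f : DForm (Amb n) s}, Continuous f → ∀ v, Continuous fun t => f t v :=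
    fun hf v => (contDiff_form_apply (contDiff_zero.2 hf) v).continuous
  rw [gwq, ← integral_finsetSum]
  · simp only [Finset.sum_mul]
  · intro J _
    exact hCq.continuousOn_mul ((hev he _).mul (hev he' _)).continuousOn
      (isCompact_element K)

theorem hasDerivWithinAt_gwq {K : Fin (n + 1) ↪o ι} {Cq : Amb n → ℝ}
    (hCq : IntegrableOn Cq (convexHull ℝ (Set.range fun a => M.vert (K a))))
    {I : Set ℝ} {t : ℝ} (ht : t ∈ I) {e : ℝ → DForm (Amb n) s} {e' : DForm (Amb n) s}
    (he : ∀ τ ∈ I, e τ ∈ EqSpace n s r c) (he'W : e' ∈ EqSpace n s r c)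
    (he' : ∀ x, HasDerivWithinAt (fun τ => e τ x) (e' x) I t) :
    HasDerivWithinAt (fun τ => gwq M Cq K (e τ) (e τ)) (2 * gwq M Cq K (e t) e') I t := by
  have hcont : ∀ f ∈ EqSpace n s r c, Continuous f := fun f hf =>
    (contDiff_of_mem_polyForms (N := 0) (EqSpace_le c hf)).continuous
  have hmem : ∀ f ∈ EqSpace n s r c, ∀ v, (fun x => f x v) ∈ polyFun n (r + 1) :=
    fun f hf v => apply_mem_polyFun (EqSpace_le c hf) v
  have hder : HasDerivWithinAt (fun τ => ∑ J : Fin s ↪o Fin n,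
      ∫ x in convexHull ℝ (Set.range fun a => M.vert (K a)),
        e τ x (fun l => EuclideanSpace.single (J l) 1) *
          e τ x (fun l => EuclideanSpace.single (J l) 1) * Cq x) _ I t :=
    HasDerivWithinAt.fun_sum fun J _ =>
      hasDerivWithinAt_integral_mul (isCompact_element K) hCq
        (polyFun n (r + 1)) (fun _ => continuous_of_mem_polyFun) ht
        (fun τ hτ => hmem _ (he τ hτ) _) (fun τ hτ => hmem _ (he τ hτ) _) (hmem _ he'W _)
        (hmem _ he'W _) (fun x => hasDerivWithinAt_form_apply (he' x) _)
        (fun x => hasDerivWithinAt_form_apply (he' x) _)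
  refine (hder.congr (fun τ hτ => gwq_eq_sum K hCq (hcont _ (he τ hτ)) (hcont _ (he τ hτ)))
    (gwq_eq_sum K hCq (hcont _ (he t ht)) (hcont _ (he t ht)))).congr_deriv ?_
  rw [Finset.sum_add_distrib, ← gwq_eq_sum K hCq (hcont _ he'W) (hcont _ (he t ht)),
    ← gwq_eq_sum K hCq (hcont _ (he t ht)) (hcont _ he'W)]
  have : gwq M Cq K e' (e t) = gwq M Cq K (e t) e' := by
    simp only [gwq, mul_comm (e' _ _)]
  rw [this]
  ring

end Energy

/-! ### Power balance of the discretization -/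

section Balance

variable {n : ℕ} {ι : Type*} [LinearOrder ι] (M : Mesh n ι) {s r : ℕ} {c : Family}

/-- A sum over all facets of all elements, arranged by the faces of the tessellation. -/
theorem sum_elems_facets (hn : 0 < n) (LR : M.LeftRight)
    (H : (Fin (n + 1) ↪o ι) × Fin (n + 1) → ℝ) :
    ∑ K ∈ M.elems, ∑ i, H (K, i) =
      ∑ F ∈ M.externalFaces, ∑ S ∈ M.sides F, H S +
        ∑ F ∈ M.internalFaces, (H (LR.left F) + H (LR.right F)) := by
  classical
  have hint : ∑ F ∈ M.internalFaces, (H (LR.left F) + H (LR.right F)) =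
      ∑ F ∈ M.internalFaces, ∑ S ∈ M.sides F, H S := by
    refine Finset.sum_congr rfl fun F hF => ?_
    rw [sides_eq_pair M hn LR hF, Finset.sum_pair (LR.left_ne_right F hF)]
  have hext : M.externalFaces = M.faces.filter fun F => ¬ 1 < (M.sides F).card := by
    refine Finset.filter_congr fun F hF => ?_
    obtain ⟨S, hS, rfl⟩ := Finset.mem_image.1 hF
    have : 0 < (M.sides (facet S.1 S.2)).card :=
      Finset.card_pos.2 ⟨S, (mem_sides M).2 ⟨(Finset.mem_product.1 hS).1, rfl⟩⟩
    omega
  rw [hint, hext, Mesh.internalFaces,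
    add_comm (∑ F ∈ M.faces with ¬ 1 < (M.sides F).card, ∑ S ∈ M.sides F, H S),
    Finset.sum_filter_add_sum_filter_not, ← Finset.sum_product' M.elems Finset.univ
      fun K i => H (K, i)]
  have hmaps : ∀ S ∈ M.elems ×ˢ (Finset.univ : Finset (Fin (n + 1))), facet S.1 S.2 ∈ M.faces :=
    fun S hS => Finset.mem_image.2 ⟨S, hS, rfl⟩
  rw [← Finset.sum_fiberwise_of_maps_to hmaps]
  refine Finset.sum_congr rfl fun F _ => Finset.sum_congr ?_ fun _ _ => rfl
  ext S
  simp [mem_sides]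

theorem faceForm_sub_left {a a' : BdQ n s} {b : BdP n s} (ha : a ∈ contBdQ n s r)
    (ha' : a' ∈ contBdQ n s r) (hb : b ∈ contBdP n s r) :
    faceForm r (a - a') b = faceForm r a b - faceForm r a' b := by
  rw [sub_eq_add_neg, ← neg_one_smul ℝ a', faceForm_add_left ha (Submodule.smul_mem _ _ ha') hb,
    faceForm_smul_left]
  ring

theorem faceForm_sub_right {a : BdQ n s} {b b' : BdP n s} (ha : a ∈ contBdQ n s r)
    (hb : b ∈ contBdP n s r) (hb' : b' ∈ contBdP n s r) :
    faceForm r a (b - b') = faceForm r a b - faceForm r a b' := by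
  rw [sub_eq_add_neg, ← neg_one_smul ℝ b', faceForm_add_right ha hb (Submodule.smul_mem _ _ hb'),
    faceForm_smul_right]
  ring

theorem faceForm_comb_left {a a' : BdQ n s} {b : BdP n s} (x y : ℝ) (ha : a ∈ contBdQ n s r)
    (ha' : a' ∈ contBdQ n s r) (hb : b ∈ contBdP n s r) :
    faceForm r (x • a + y • a') b = x * faceForm r a b + y * faceForm r a' b := by
  rw [faceForm_add_left (Submodule.smul_mem _ _ ha) (Submodule.smul_mem _ _ ha') hb,
    faceForm_smul_left, faceForm_smul_left]

theorem faceForm_comb_right {a : BdQ n s} {b b' : BdP n s} (x y : ℝ) (ha : a ∈ contBdQ n s r)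
    (hb : b ∈ contBdP n s r) (hb' : b' ∈ contBdP n s r) :
    faceForm r a (x • b + y • b') = x * faceForm r a b + y * faceForm r a b' := by
  rw [faceForm_add_right ha (Submodule.smul_mem _ _ hb) (Submodule.smul_mem _ _ hb'),
    faceForm_smul_right, faceForm_smul_right]

variable {M} {βp : (Fin (n + 1) ↪o ι) → EpVec n s} {βq : (Fin (n + 1) ↪o ι) → DForm (Amb n) s}
  {uP : (Fin (n + 1) ↪o ι) → Fin (n + 1) → BdP n s}
  {uQ : (Fin (n + 1) ↪o ι) → Fin (n + 1) → BdQ n s}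

/-- On an external face, the flux terms and the boundary term of the integration by parts combine to
the supplied power. -/
theorem external_face_balance {K : Fin (n + 1) ↪o ι} {i : Fin (n + 1)}
    (hp : MemEp M r c K (βp K)) (hq : βq K ∈ EqSpace n s r c)
    (huP : uP K i ∈ contBdP n s r) (huQ : uQ K i ∈ contBdQ n s r) :
    (-1) ^ (s + 1) * pairFace M r K i (fluxQExt M βq uQ K i) (trp i (βp K)) +
      (-1) ^ (s + 1) * pairFace M r K i (trq M K i (βq K)) (fluxPExt βp uP K i) +
      (-1) ^ s * pairFace M r K i (trq M K i (βq K)) (trp i (βp K)) =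
    portPower M r βp βq uP uQ K i := by
  have hP := trp_mem_contBdP hp i
  have hQ := trq_mem_contBdQ (M := M) hq K i
  simp only [portPower, pairFace_eq, fluxQExt, fluxPExt, outP, outQ]
  rw [faceForm_sub_left (Submodule.smul_mem _ _ hQ) huQ hP,
    faceForm_sub_right hQ (Submodule.smul_mem _ _ hP) huP]
  simp only [faceForm_smul_left, faceForm_smul_right]
  ring

variable (LR : M.LeftRight) {F : Fin n ↪o ι}

theorem elemSign_left_right (hn : 0 < n) (hF : F ∈ M.internalFaces) :
    M.elemSign (LR.left F).1 * (-1) ^ ((LR.left F).2 : ℕ) =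
      -(M.elemSign (LR.right F).1 * (-1) ^ ((LR.right F).2 : ℕ)) := by
  obtain ⟨hL, hLF⟩ := (mem_sides M).1 (LR.left_mem F hF)
  obtain ⟨hR, hRF⟩ := (mem_sides M).1 (LR.right_mem F hF)
  exact elemSign_opposite M hn hL hR (hLF.trans hRF.symm) (LR.left_ne_right F hF)

/-- On an internal face, the flux terms and the boundary terms of the integration by parts
cancel. -/
theorem internal_face_balance (hn : 0 < n) (θ : ℝ) (hF : F ∈ M.internalFaces)
    (hp : ∀ K ∈ M.elems, MemEp M r c K (βp K)) (hq : ∀ K ∈ M.elems, βq K ∈ EqSpace n s r c) :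
    (-1) ^ (s + 1) * (pairFace M r (LR.left F).1 (LR.left F).2 (fluxQ M θ LR βq F)
          (trp (LR.left F).2 (βp (LR.left F).1)) +
        pairFace M r (LR.right F).1 (LR.right F).2 (fluxQ M θ LR βq F)
          (trp (LR.right F).2 (βp (LR.right F).1))) +
      (-1) ^ (s + 1) * (pairFace M r (LR.left F).1 (LR.left F).2
          (trq M (LR.left F).1 (LR.left F).2 (βq (LR.left F).1)) (fluxP M θ LR βp F) +
        pairFace M r (LR.right F).1 (LR.right F).2
          (trq M (LR.right F).1 (LR.right F).2 (βq (LR.right F).1)) (fluxP M θ LR βp F)) +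
      (-1) ^ s * (pairFace M r (LR.left F).1 (LR.left F).2
          (trq M (LR.left F).1 (LR.left F).2 (βq (LR.left F).1))
          (trp (LR.left F).2 (βp (LR.left F).1)) +
        pairFace M r (LR.right F).1 (LR.right F).2
          (trq M (LR.right F).1 (LR.right F).2 (βq (LR.right F).1))
          (trp (LR.right F).2 (βp (LR.right F).1))) = 0 := by
  have hL := ((mem_sides M).1 (LR.left_mem F hF)).1
  have hR := ((mem_sides M).1 (LR.right_mem F hF)).1
  have hPL := trp_mem_contBdP (hp _ hL) (LR.left F).2
  have hPR := trp_mem_contBdP (hp _ hR) (LR.right F).2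
  have hQL := trq_mem_contBdQ (M := M) (hq _ hL) (LR.left F).1 (LR.left F).2
  have hQR := trq_mem_contBdQ (M := M) (hq _ hR) (LR.right F).1 (LR.right F).2
  simp only [pairFace_eq, fluxQ, fluxP, elemSign_left_right LR hn hF]
  rw [faceForm_comb_left _ _ hQL hQR hPL, faceForm_comb_left _ _ hQL hQR hPR,
    faceForm_comb_right _ _ hQL hPL hPR, faceForm_comb_right _ _ hQR hPL hPR]
  ring

/-- The interconnection structure is power conserving: the two sides of an internal face are
oppositely oriented. -/
theorem portPower_left_add_right (hn : 0 < n) {θ : ℝ} (hF : F ∈ M.internalFaces)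
    (hp : ∀ K ∈ M.elems, MemEp M r c K (βp K)) (hq : ∀ K ∈ M.elems, βq K ∈ EqSpace n s r c)
    (h : InterconnectedAt M θ LR βp βq uP uQ F) :
    portPower M r βp βq uP uQ (LR.left F).1 (LR.left F).2 +
      portPower M r βp βq uP uQ (LR.right F).1 (LR.right F).2 = 0 := by
  have hL := ((mem_sides M).1 (LR.left_mem F hF)).1
  have hR := ((mem_sides M).1 (LR.right_mem F hF)).1
  have hPL := trp_mem_contBdP (hp _ hL) (LR.left F).2
  have hPR := trp_mem_contBdP (hp _ hR) (LR.right F).2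
  have hQL := trq_mem_contBdQ (M := M) (hq _ hL) (LR.left F).1 (LR.left F).2
  have hQR := trq_mem_contBdQ (M := M) (hq _ hR) (LR.right F).1 (LR.right F).2
  obtain ⟨h1, h2, h3, h4⟩ := h
  rw [neg_eq_iff_eq_neg, ← neg_one_smul ℝ (_ + _)] at h3 h4
  simp only [portPower, pairFace_eq, outP, outQ, faceForm_smul_left, faceForm_smul_right,
    elemSign_left_right LR hn hF, h1, h2, h3, h4]
  rw [faceForm_comb_left _ _ hQL hQR hPL, faceForm_comb_left _ _ hQL hQR hPR,
    faceForm_comb_right _ _ hQL hPL hPR, faceForm_comb_right _ _ hQR hPL hPR]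
  ring

/-- The power balance: testing the two equations with the solution itself. -/
theorem power_balance (hn : 0 < n) {θ : ℝ}
    (hp : ∀ K ∈ M.elems, MemEp M r c K (βp K)) (hq : ∀ K ∈ M.elems, βq K ∈ EqSpace n s r c)
    (huP : ∀ F ∈ M.externalFaces, ∀ S ∈ M.sides F, MemBdP M r c F (uP S.1 S.2))
    (huQ : ∀ F ∈ M.externalFaces, ∀ S ∈ M.sides F, MemBdQ M r c F (uQ S.1 S.2))
    {fp : (Fin (n + 1) ↪o ι) → DForm (Amb n) (s + 1)} {fq : (Fin (n + 1) ↪o ι) → FqVec n s}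
    (hP : WeakEqP M r c θ LR βq fp uQ) (hQ : WeakEqQ M r c θ LR βp fq uP) :
    ∑ K ∈ M.elems, (pairEpFp M r K (βp K) (fp K) + pairEqFq M r K (βq K) (fq K)) =
      ∑ F ∈ M.externalFaces, ∑ S ∈ M.sides F, portPower M r βp βq uP uQ S.1 S.2 := by
  have hStokes := Finset.sum_congr rfl fun K hK => sum_pairFace_eq M r K
    (contDiff_of_mem_polyForms (EqSpace_le c (hq K hK)))
    (fun j φ => (hp K hK).contDiff j φ)
  rw [Finset.sum_add_distrib, ← Finset.mul_sum] at hStokes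
  rw [sum_elems_facets M hn LR (fun S => pairFace M r S.1 S.2 (trq M S.1 S.2 (βq S.1))
    (trp S.2 (βp S.1)))] at hStokes
  have hext := Finset.sum_congr rfl fun F hF => Finset.sum_congr rfl fun S hS =>
    external_face_balance (βp := βp) (βq := βq) (hp _ ((mem_sides M).1 hS).1)
      (hq _ ((mem_sides M).1 hS).1) (huP F hF S hS).mem_contBdP (huQ F hF S hS).mem_contBdQ
  have hint := Finset.sum_congr rfl fun F hF =>
    internal_face_balance LR hn θ hF hp hq
  simp only [Finset.sum_add_distrib, ← Finset.mul_sum, Finset.sum_const_zero] at hext hint hStokes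
  rw [Finset.sum_add_distrib, hP βp hp, hQ βq hq]
  simp only [Finset.sum_add_distrib]
  have h1 : ((-1 : ℝ) ^ s) * (-1) ^ s = 1 := by rw [← mul_pow]; simp
  have h2 : ((-1 : ℝ) ^ (s + 1 + 1)) = (-1) ^ s := by ring
  rw [h2]
  linear_combination hext + hint - (-1) ^ s * hStokes -
    (∑ K ∈ M.elems, pairEqFq M r K (βq K) (dqp (βp K))) * h1

end Balance

end PHDG

end

theorem theorem7p1 {ι : Type*} [LinearOrder ι]
    -- degrees `p + q = n + 1`, polynomial order `r`, and the family of discrete spaces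
    (n p q r : ℕ) (hp : 1 ≤ p) (hq : 1 ≤ q) (hpq : p + q = n + 1) (hr : 1 ≤ r) (c : PHDG.Family)
    -- the tessellation, the labelling of the two sides of its internal faces, and the parameter `θ`
    (M : PHDG.Mesh n ι) (LR : M.LeftRight) (θ : ℝ) (hθ : θ ∈ Set.Icc (0 : ℝ) 1)
    -- the coefficient functions
    (Cp Cq : PHDG.Amb n → ℝ)
    (hCp : ∀ K ∈ M.elems, ∀ j < r, ∀ φ : Fin (n - q + j + 2) ↪o Fin (n + 1),
      IntegrableOn (fun t => Cp (PHDG.param (M.sub K φ) t)) (PHDG.refSimplex (n - q + j + 1)))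
    (hCq : ∀ K ∈ M.elems, IntegrableOn Cq (convexHull ℝ (Set.range fun a => M.vert (K a))))
    -- the time interval
    (I : Set ℝ)
    -- the discrete solution `β^p(t) ∈ E_p(𝒯_h)`, `β^q(t) ∈ E_q(𝒯_h)`
    (βp : ℝ → (Fin (n + 1) ↪o ι) → PHDG.EpVec n (n - q))
    (βq : ℝ → (Fin (n + 1) ↪o ι) → PHDG.DForm (PHDG.Amb n) (n - q))
    (hβp : ∀ t ∈ I, ∀ K ∈ M.elems, PHDG.MemEp M r c K (βp t K))
    (hβq : ∀ t ∈ I, ∀ K ∈ M.elems, βq t K ∈ PHDG.EqSpace n (n - q) r c)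
    -- its time derivative
    (βp' : ℝ → (Fin (n + 1) ↪o ι) → PHDG.EpVec n (n - q))
    (βq' : ℝ → (Fin (n + 1) ↪o ι) → PHDG.DForm (PHDG.Amb n) (n - q))
    (hβp'_mem : ∀ t ∈ I, ∀ K ∈ M.elems, PHDG.MemEp M r c K (βp' t K))
    (hβq'_mem : ∀ t ∈ I, ∀ K ∈ M.elems, βq' t K ∈ PHDG.EqSpace n (n - q) r c)
    (hβp' : ∀ t ∈ I, ∀ K ∈ M.elems, ∀ j φ x,
      HasDerivWithinAt (fun τ => βp τ K j φ x) (βp' t K j φ x) I t)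
    (hβq' : ∀ t ∈ I, ∀ K ∈ M.elems, ∀ x,
      HasDerivWithinAt (fun τ => βq τ K x) (βq' t K x) I t)
    -- the discrete Hodge stars `⋆_p β^p`, `⋆_q β^q` and `⋆_p β̇^p`, `⋆_q β̇^q`
    (starβp : ℝ → (Fin (n + 1) ↪o ι) → PHDG.DForm (PHDG.Amb n) (n - q + 1))
    (starβq : ℝ → (Fin (n + 1) ↪o ι) → PHDG.FqVec n (n - q))
    (starβp' : ℝ → (Fin (n + 1) ↪o ι) → PHDG.DForm (PHDG.Amb n) (n - q + 1))
    (starβq' : ℝ → (Fin (n + 1) ↪o ι) → PHDG.FqVec n (n - q))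
    (hstarp : ∀ t ∈ I, ∀ K ∈ M.elems, PHDG.IsHodgeStarP M r c Cp K (βp t K) (starβp t K))
    (hstarq : ∀ t ∈ I, ∀ K ∈ M.elems, PHDG.IsHodgeStarQ M r c Cq K (βq t K) (starβq t K))
    (hstarp' : ∀ t ∈ I, ∀ K ∈ M.elems, PHDG.IsHodgeStarP M r c Cp K (βp' t K) (starβp' t K))
    (hstarq' : ∀ t ∈ I, ∀ K ∈ M.elems, PHDG.IsHodgeStarQ M r c Cq K (βq' t K) (starβq' t K))
    -- the boundary inputs: arbitrary on the external faces, given by the interconnection structure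
    -- on the internal faces
    (uP : ℝ → (Fin (n + 1) ↪o ι) → Fin (n + 1) → PHDG.BdP n (n - q))
    (uQ : ℝ → (Fin (n + 1) ↪o ι) → Fin (n + 1) → PHDG.BdQ n (n - q))
    (huP : ∀ t ∈ I, ∀ F ∈ M.externalFaces, ∀ S ∈ M.sides F, PHDG.MemBdP M r c F (uP t S.1 S.2))
    (huQ : ∀ t ∈ I, ∀ F ∈ M.externalFaces, ∀ S ∈ M.sides F, PHDG.MemBdQ M r c F (uQ t S.1 S.2))
    (hinter : ∀ t ∈ I, ∀ F ∈ M.internalFaces,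
      PHDG.InterconnectedAt M θ LR (βp t) (βq t) (uP t) (uQ t) F)
    -- the port-Hamiltonian DG discretization
    (hweakP : ∀ t ∈ I, PHDG.WeakEqP M r c θ LR (βq t) (starβp' t) (uQ t))
    (hweakQ : ∀ t ∈ I, PHDG.WeakEqQ M r c θ LR (βp t) (starβq' t) (uP t)) :
    ∀ t ∈ I,
      HasDerivWithinAt
        (fun τ => PHDG.energy M r (βp τ) (starβp τ) (βq τ) (starβq τ))
        (2 * ∑ F ∈ M.externalFaces, ∑ S ∈ M.sides F,
          (PHDG.pairFace M r S.1 S.2 (PHDG.outQ M (βq t) S.1 S.2) (uP t S.1 S.2) +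
            PHDG.pairFace M r S.1 S.2 (uQ t S.1 S.2) (PHDG.outP (βp t) S.1 S.2))) I t ∧
      ∀ F ∈ M.internalFaces,
        PHDG.portPower M r (βp t) (βq t) (uP t) (uQ t) (LR.left F).1 (LR.left F).2 +
          PHDG.portPower M r (βp t) (βq t) (uP t) (uQ t) (LR.right F).1 (LR.right F).2 = 0 := by
  have hn : 0 < n := by omega
  intro t ht
  refine ⟨?_, fun F hF => PHDG.portPower_left_add_right LR hn hF (hβp t ht) (hβq t ht)
    (hinter t ht F hF)⟩
  -- on `I` the energy is the sum of the weighted inner products that define the Hodge stars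
  have hE : ∀ τ ∈ I, PHDG.energy M r (βp τ) (starβp τ) (βq τ) (starβq τ) =
      ∑ K ∈ M.elems, (PHDG.gwp M r Cp K (βp τ K) (βp τ K) + PHDG.gwq M Cq K (βq τ K) (βq τ K)) :=
    fun τ hτ => Finset.sum_congr rfl fun K hK => by
      rw [(hstarp τ hτ K hK).2 _ (hβp τ hτ K hK), (hstarq τ hτ K hK).2 _ (hβq τ hτ K hK)]
  have hder : HasDerivWithinAt (fun τ => ∑ K ∈ M.elems,
      (PHDG.gwp M r Cp K (βp τ K) (βp τ K) + PHDG.gwq M Cq K (βq τ K) (βq τ K)))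
      (∑ K ∈ M.elems, (2 * PHDG.gwp M r Cp K (βp t K) (βp' t K) +
        2 * PHDG.gwq M Cq K (βq t K) (βq' t K))) I t :=
    HasDerivWithinAt.fun_sum fun K hK =>
      (PHDG.hasDerivWithinAt_gwp (hCp K hK) ht (fun τ hτ => hβp τ hτ K hK) (hβp'_mem t ht K hK)
        (hβp' t ht K hK)).add
      (PHDG.hasDerivWithinAt_gwq (hCq K hK) ht (fun τ hτ => hβq τ hτ K hK) (hβq'_mem t ht K hK)
        (hβq' t ht K hK))
  refine (hder.congr hE (hE t ht)).congr_deriv ?_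
  refine Eq.trans ?_ (congrArg (2 * ·) (PHDG.power_balance LR hn (hβp t ht) (hβq t ht) (huP t ht)
    (huQ t ht) (hweakP t ht) (hweakQ t ht)))
  simp only [Finset.mul_sum, mul_add]
  refine Finset.sum_congr rfl fun K hK => ?_
  rw [(hstarp' t ht K hK).2 _ (hβp t ht K hK), (hstarq' t ht K hK).2 _ (hβq t ht K hK)]
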